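/- Conventions. An étale groupoid is a locally compact Hausdorff topological groupoid $G$, with unit space $G^{(0)}$, source map $s$ and range map $r$, such that $r:G\to G^{(0)}$ is a local homeomorphism; $g h$ is defined when $s(g)=r(h)$, and $G^{(2)}$ is the space of such pairs $(g,h)$. A $G$-set is a subset $U\subset G$ on which $r$ and $s$ are injective; for an open $G$-set $U$ let $\tau_U=r\circ(s|_U)^{-1}:s(U)\to r(U)$. $G$ is essentially principal if the interior of $\{g\in G: r(g)=s(g)\}$ is $G^{(0)}$. If $G^{(0)}$ is compact, the topological full group $[[G]]$ is the group of all homeomorphisms of $G^{(0)}$ of the form $\tau_U$ with $U$ a compact open $G$-set. For a local homeomorphism $\pi:X\to Y$ of locally compact Hausdorff spaces and $f\in C_c(X,\mathbb Z)$ (continuous, compactly supported), put $\pi_*(f)(y)=\sum_{\pi(x)=y}f(x)$. Then $H_1(G)=\ker\delta_1/\operatorname{Im}\delta_2$, where $\delta_1=s_*-r_*:C_c(G,\mathbb Z)\to C_c(G^{(0)},\mathbb Z)$ and $\delta_2=d_{0*}-d_{1*}+d_{2*}:C_c(G^{(2)},\mathbb Z)\to C_c(G,\mathbb Z)$ with $d_0(g,h)=h$,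 $d_1(g,h)=gh$, $d_2(g,h)=g$. A subgroupoid $K\subset G$ is elementary if it is compact and open, contains $G^{(0)}$, and is principal (every $g\in K$ with $r(g)=s(g)$ is a unit). For $x\in G^{(0)}$ let $Kx=\{g\in K:s(g)=x\}$ and $K(x)=r(Kx)$. $G$ is almost finite if for every compact $C\subset G$ and every $\varepsilon>0$ there is an elementary subgroupoid $K\subset G$ such that $|CKx\setminus Kx|/|K(x)|<\varepsilon$ for all $x\in G^{(0)}$. Theorem. Let $G$ be a second countable, essentially principal étale groupoid whose unit space is compact and totally disconnected. For $\gamma\in[[G]]$ there is a unique compact open $G$-set $U$ with $\gamma=\tau_U$, and the characteristic function $1_U$ lies in $\ker\delta_1$; let $I:[[G]]\to H_1(G)$, $I(\tau_U)=[1_U]$, be the index map. If $G$ is almost finite, then $I$ is surjective. -/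

import Mathlib

open Set Topology
open scoped CompactlySupported

noncomputable section

universe u v

/-! ### Pushforward of compactly supported integer-valued functions along étale maps -/

section Pushforward

variable {X : Type u} {Y : Type v} [TopologicalSpace X] [TopologicalSpace Y]

theorem isClopen_support_of_cc (f : C_c(X, ℤ)) : IsClopen (Function.support f) := by
  have : Function.support f = f ⁻¹' {0}ᶜ := by ext; simp
  rw [this]
  exact (isClopen_discrete _).preimage f.continuous

theorem isCompact_support_of_cc (f : C_c(X, ℤ)) : IsCompact (Function.support f) := by
  have h : IsCompact (tsupport f) := f.hasCompactSupport
  rwa [tsupport, (isClopen_support_of_cc f).isClosed.closure_eq] at h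

theorem finite_fiber_inter [T1Space Y] {p : X → Y} (hp : IsLocalHomeomorph p)
    {K : Set X} (hK : IsCompact K) (y : Y) : (p ⁻¹' {y} ∩ K).Finite := by
  have hc : IsCompact (p ⁻¹' {y} ∩ K) :=
    hK.inter_left (isClosed_singleton.preimage hp.continuous)
  refine hc.finite ?_
  refine (hp.isLocalHomeomorphOn (s := p ⁻¹' {y} ∩ K)).isDiscrete_of_image ?_
  have hs : (p '' (p ⁻¹' {y} ∩ K)).Subsingleton := by
    rintro _ ⟨a, ha, rfl⟩ _ ⟨b, hb, rfl⟩
    have h1 : p a = y := ha.1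
    have h2 : p b = y := hb.1
    rw [h1, h2]
  exact hs.isDiscrete

theorem continuous_fiberSum [T2Space X] [T2Space Y] {p : X → Y} (hp : IsLocalHomeomorph p)
    (f : C_c(X, ℤ)) : Continuous fun y => ∑ᶠ x ∈ p ⁻¹' {y}, f x := by
  classical
  rw [continuous_iff_continuousAt]
  intro y₀
  set K := Function.support f with hKdef
  have hK : IsCompact K := isCompact_support_of_cc f
  set F := p ⁻¹' {y₀} ∩ K with hFdef
  have hF : F.Finite := finite_fiber_inter hp hK y₀
  obtain ⟨U, hU, hUd⟩ := hF.t2_separation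
  choose e hes hee using hp
  set W : X → Set X := fun x => U x ∩ (e x).source ∩ f ⁻¹' {f x} with hW
  have hWo : ∀ x, IsOpen (W x) := fun x =>
    ((hU x).2.inter (e x).open_source).inter ((isOpen_discrete _).preimage f.continuous)
  have hxW : ∀ x, x ∈ W x := fun x => ⟨⟨(hU x).1, hes x⟩, rfl⟩
  have hWi : ∀ x, InjOn p (W x) := fun x a ha b hb hab => by
    rw [hee x] at hab
    exact (e x).injOn ha.1.2 hb.1.2 hab
  have hp : IsLocalHomeomorph p := fun x => ⟨e x, hes x, hee x⟩
  have h1 : ∀ᶠ y in 𝓝 y₀, ∀ x ∈ F, y ∈ p '' W x := by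
    rw [Filter.eventually_all_finite hF]
    intro x hx
    refine (hp.isOpenMap _ (hWo x)).mem_nhds ⟨x, hxW x, hx.1⟩
  have h2 : ∀ᶠ y in 𝓝 y₀, y ∉ p '' (K \ ⋃ x ∈ F, W x) := by
    have hc : IsCompact (K \ ⋃ x ∈ F, W x) :=
      hK.diff (isOpen_biUnion fun x _ => hWo x)
    refine (hc.image hp.continuous).isClosed.isOpen_compl.mem_nhds ?_
    rintro ⟨x, ⟨hxK, hx⟩, hxy⟩
    exact hx (mem_biUnion (show x ∈ F from ⟨hxy, hxK⟩) (hxW x))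
  have h3 : ∀ᶠ y in 𝓝 y₀,
      ∑ᶠ x ∈ p ⁻¹' {y₀}, f x = ∑ᶠ x ∈ p ⁻¹' {y}, f x := by
    filter_upwards [h1, h2] with y hy1 hy2
    rw [← finsum_mem_inter_support, ← finsum_mem_inter_support _ (p ⁻¹' {y})]
    choose! σ hσ hσp using hy1
    refine finsum_mem_eq_of_bijOn σ ⟨?_, ?_, ?_⟩ ?_
    · intro x hx
      refine ⟨hσp x hx, ?_⟩
      have : f (σ x) = f x := (hσ x hx).2
      simpa [this] using hx.2
    · intro a ha b hb hab
      by_contra hne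
      have hd := hUd ha hb hne
      exact Set.disjoint_left.mp hd (hσ a ha).1.1 (hab ▸ (hσ b hb).1.1)
    · rintro x ⟨hxy, hxK⟩
      have : x ∈ ⋃ z ∈ F, W z := by
        by_contra hx
        exact hy2 ⟨x, ⟨hxK, hx⟩, hxy⟩
      simp only [mem_iUnion] at this
      obtain ⟨z, hz, hxz⟩ := this
      refine ⟨z, hz, hWi z (hσ z hz) hxz ?_⟩
      rw [hσp z hz]; exact hxy.symm
    · intro x hx
      exact (hσ x hx).2.symm
  exact (continuousAt_const (y := ∑ᶠ x ∈ p ⁻¹' {y₀}, f x)).congr h3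

/-- The homomorphism `p_* : C_c(X, ℤ) → C_c(Y, ℤ)` induced by a local homeomorphism `p : X → Y`,
`p_* f (y) = ∑_{p x = y} f x` (only finitely many terms are nonzero). -/
def pushforward [T2Space X] [T2Space Y] (p : X → Y) (hp : IsLocalHomeomorph p) :
    C_c(X, ℤ) →+ C_c(Y, ℤ) where
  toFun f :=
    { toFun := fun y => ∑ᶠ x ∈ p ⁻¹' {y}, f x
      continuous_toFun := continuous_fiberSum hp f
      hasCompactSupport' := by
        refine HasCompactSupport.intro ((isCompact_support_of_cc f).image hp.continuous) ?_
        intro y hy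
        refine finsum_mem_eq_zero_of_forall_eq_zero fun x hx => ?_
        by_contra hne
        exact hy ⟨x, hne, hx⟩ }
  map_zero' := by
    ext y
    simp
  map_add' f g := by
    ext y
    exact finsum_mem_add_distrib' (finite_fiber_inter hp (isCompact_support_of_cc f) y)
      (finite_fiber_inter hp (isCompact_support_of_cc g) y)

theorem pushforward_apply [T2Space X] [T2Space Y] (p : X → Y) (hp : IsLocalHomeomorph p)
    (f : C_c(X, ℤ)) (y : Y) : pushforward p hp f y = ∑ᶠ x ∈ p ⁻¹' {y}, f x := rfl

theorem pushforward_comp [T2Space X] [T2Space Y] {Z : Type*} [TopologicalSpace Z] [T2Space Z]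
    (p : X → Y) (hp : IsLocalHomeomorph p) (q : Y → Z) (hq : IsLocalHomeomorph q)
    (r : X → Z) (hr : IsLocalHomeomorph r) (h : ∀ x, q (p x) = r x) (f : C_c(X, ℤ)) :
    pushforward q hq (pushforward p hp f) = pushforward r hr f := by
  ext z
  simp only [pushforward_apply]
  set K := Function.support f
  have hK : IsCompact K := isCompact_support_of_cc f
  have hT : (r ⁻¹' {z} ∩ K).Finite := finite_fiber_inter hr hK z
  have hU : r ⁻¹' {z} ∩ K = ⋃ y ∈ p '' (r ⁻¹' {z} ∩ K), p ⁻¹' {y} ∩ K := by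
    ext x
    simp only [mem_iUnion, mem_image, exists_prop, mem_inter_iff, mem_preimage, mem_singleton_iff]
    constructor
    · rintro ⟨hx, hxK⟩
      exact ⟨p x, ⟨x, ⟨hx, hxK⟩, rfl⟩, rfl, hxK⟩
    · rintro ⟨_, ⟨x', ⟨hx', -⟩, rfl⟩, hpx, hxK⟩
      exact ⟨by rw [← h, hpx, h, hx'], hxK⟩
  rw [← finsum_mem_inter_support (⇑f) (r ⁻¹' {z})]
  change _ = ∑ᶠ x ∈ r ⁻¹' {z} ∩ K, f x
  rw [hU, finsum_mem_biUnion _ (hT.image p) fun y _ => finite_fiber_inter hp hK y]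
  · rw [finsum_mem_inter_support_eq' (fun y => ∑ᶠ x ∈ p ⁻¹' {y} ∩ K, f x)
      (p '' (r ⁻¹' {z} ∩ K)) (q ⁻¹' {z})]
    · refine finsum_mem_congr rfl fun y _ => ?_
      exact (finsum_mem_inter_support _ _).symm
    · intro y hy
      have hne : ∑ᶠ x ∈ p ⁻¹' {y} ∩ K, f x ≠ 0 := hy
      obtain ⟨x, hx, hfx⟩ := exists_ne_zero_of_finsum_mem_ne_zero hne
      have hpx : p x = y := hx.1
      constructor
      · rintro ⟨x', hx', rfl⟩
        show q (p x') = z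
        rw [h]; exact hx'.1
      · intro hq'
        exact ⟨x, ⟨by show r x = z; rw [← h, hpx]; exact hq', hx.2⟩, hpx⟩
  · intro a _ b _ hab
    refine Set.disjoint_left.mpr ?_
    rintro x ⟨h1, -⟩ ⟨h2, -⟩
    exact hab (h1.symm.trans h2)

/-- The characteristic function `1_U` of a compact open set. -/
def charFn [T2Space X] (U : Set X) (ho : IsOpen U) (hc : IsCompact U) : C_c(X, ℤ) where
  toFun := U.indicator fun _ => 1
  continuous_toFun := continuous_const.indicator (fun a ha => by
    rw [IsClopen.frontier_eq ⟨hc.isClosed, ho⟩] at ha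
    exact ha.elim)
  hasCompactSupport' := HasCompactSupport.intro hc fun _ hx => indicator_of_notMem hx _

theorem pushforward_charFn [T2Space X] [T2Space Y] (p : X → Y)
    (hp : IsLocalHomeomorph p) {U : Set X} (ho : IsOpen U) (hc : IsCompact U)
    (hi : InjOn p U) (hU : p '' U = univ) (y : Y) :
    pushforward p hp (charFn U ho hc) y = 1 := by
  obtain ⟨g, hg, rfl⟩ : y ∈ p '' U := hU ▸ mem_univ y
  have h1 : ∀ x, charFn U ho hc x = U.indicator (fun _ => (1 : ℤ)) x := fun _ => rfl
  have h2 : p ⁻¹' {p g} ∩ Function.support (charFn U ho hc) = {g} := by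
    ext x
    simp only [mem_inter_iff, mem_preimage, mem_singleton_iff, Function.mem_support, h1]
    constructor
    · rintro ⟨hx, hxU⟩
      exact hi (mem_of_indicator_ne_zero hxU) hg hx
    · rintro rfl
      exact ⟨rfl, by simp [hg]⟩
  rw [pushforward_apply, ← finsum_mem_inter_support, h2, finsum_mem_singleton, h1]
  simp [hg]

end Pushforward

/-! ### Étale groupoids -/

/-- An étale groupoid: a locally compact Hausdorff topological groupoid whose range map is a
local homeomorphism. `G` is the space of all elements (arrows), and `X` is the unit space
`G^(0)`, embedded in `G` by `unit`. The product `mul g h` is meaningful when `src g = rng h`;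
the other values of `mul` are irrelevant, nothing is assumed about them. -/
structure EtaleGroupoid (G : Type u) (X : Type v) [TopologicalSpace G] [TopologicalSpace X]
    [LocallyCompactSpace G] [T2Space G] where
  src : G → X
  rng : G → X
  unit : X → G
  inv : G → G
  mul : G → G → G
  src_unit : ∀ x, src (unit x) = x
  rng_unit : ∀ x, rng (unit x) = x
  src_mul : ∀ g h, src g = rng h → src (mul g h) = src h
  rng_mul : ∀ g h, src g = rng h → rng (mul g h) = rng g
  mul_assoc : ∀ g h k, src g = rng h → src h = rng k → mul (mul g h) k = mul g (mul h k)
  unit_mul : ∀ g, mul (unit (rng g)) g = g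
  mul_unit : ∀ g, mul g (unit (src g)) = g
  src_inv : ∀ g, src (inv g) = rng g
  rng_inv : ∀ g, rng (inv g) = src g
  inv_mul : ∀ g, mul (inv g) g = unit (src g)
  mul_inv : ∀ g, mul g (inv g) = unit (rng g)
  continuous_unit : Continuous unit
  continuous_inv : Continuous inv
  continuous_mul : ContinuousOn (fun p : G × G => mul p.1 p.2) {p | src p.1 = rng p.2}
  /-- The range map is étale. -/
  isLocalHomeomorph_rng : IsLocalHomeomorph rng

namespace EtaleGroupoid

variable {G : Type u} {X : Type v} [TopologicalSpace G] [TopologicalSpace X]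
  [LocallyCompactSpace G] [T2Space G] (𝒢 : EtaleGroupoid G X)

theorem t2Space_units (𝒢 : EtaleGroupoid G X) : T2Space X :=
  T2Space.of_injective_continuous
    (Function.LeftInverse.injective 𝒢.rng_unit) 𝒢.continuous_unit

theorem inv_inv (g : G) : 𝒢.inv (𝒢.inv g) = g := by
  have h1 := 𝒢.mul_assoc (𝒢.inv (𝒢.inv g)) (𝒢.inv g) g (𝒢.src_inv _) (𝒢.src_inv _)
  rw [𝒢.inv_mul, 𝒢.inv_mul, 𝒢.src_inv, 𝒢.unit_mul] at h1
  have h2 := 𝒢.mul_unit (𝒢.inv (𝒢.inv g))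
  rw [𝒢.src_inv, 𝒢.rng_inv] at h2
  rw [← h2]
  exact h1.symm

theorem isLocalHomeomorph_src : IsLocalHomeomorph 𝒢.src := by
  let e : G ≃ₜ G :=
    { toFun := 𝒢.inv
      invFun := 𝒢.inv
      left_inv := 𝒢.inv_inv
      right_inv := 𝒢.inv_inv
      continuous_toFun := 𝒢.continuous_inv
      continuous_invFun := 𝒢.continuous_inv }
  have h : 𝒢.src = 𝒢.rng ∘ e := funext fun g => (𝒢.rng_inv g).symm
  rw [h]
  exact 𝒢.isLocalHomeomorph_rng.comp e.isLocalHomeomorph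

theorem isOpenEmbedding_unit : IsOpenEmbedding 𝒢.unit := by
  refine 𝒢.isLocalHomeomorph_rng.isOpenEmbedding_of_comp ?_ 𝒢.continuous_unit
  have : 𝒢.rng ∘ 𝒢.unit = id := funext 𝒢.rng_unit
  rw [this]
  exact IsOpenEmbedding.id

/-- The space `G^(2)` of composable pairs. -/
abbrev Composable : Type u := {p : G × G // 𝒢.src p.1 = 𝒢.rng p.2}

/-- The face map `(g, h) ↦ h`. -/
def face₀ (p : 𝒢.Composable) : G := p.1.2

/-- The face map `(g, h) ↦ g h`. -/
def face₁ (p : 𝒢.Composable) : G := 𝒢.mul p.1.1 p.1.2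

/-- The face map `(g, h) ↦ g`. -/
def face₂ (p : 𝒢.Composable) : G := p.1.1

theorem isLocalHomeomorph_face₀ : IsLocalHomeomorph 𝒢.face₀ := by
  classical
  refine IsLocalHomeomorph.mk _ fun p => ?_
  obtain ⟨e, hpe, he⟩ := 𝒢.isLocalHomeomorph_src p.1.1
  have hes : ∀ g, e g = 𝒢.src g := fun g => by rw [he]
  have hr : Continuous 𝒢.rng := 𝒢.isLocalHomeomorph_rng.continuous
  let σ : G → 𝒢.Composable := fun h =>
    if hh : 𝒢.src (e.symm (𝒢.rng h)) = 𝒢.rng h then ⟨(e.symm (𝒢.rng h), h), hh⟩ else p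
  have hσ : ∀ h, 𝒢.rng h ∈ e.target → (σ h).1 = (e.symm (𝒢.rng h), h) := fun h hh => by
    have : 𝒢.src (e.symm (𝒢.rng h)) = 𝒢.rng h := by rw [← hes, e.right_inv hh]
    simp only [σ, dif_pos this]
  refine ⟨{ toFun := 𝒢.face₀
            invFun := σ
            source := {q | q.1.1 ∈ e.source}
            target := {h | 𝒢.rng h ∈ e.target}
            map_source' := ?_
            map_target' := ?_
            left_inv' := ?_
            right_inv' := ?_
            open_source := ?_
            open_target := ?_
            continuousOn_toFun := ?_
            continuousOn_invFun := ?_ }, hpe, fun _ _ => rfl⟩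
  · intro q hq
    show 𝒢.rng q.1.2 ∈ e.target
    rw [← q.2, ← hes]
    exact e.map_source hq
  · intro h hh
    show (σ h).1.1 ∈ e.source
    rw [hσ h hh]
    exact e.map_target hh
  · intro q hq
    have h1 : 𝒢.rng q.1.2 = e q.1.1 := by rw [hes, q.2]
    have h2 : 𝒢.rng q.1.2 ∈ e.target := by rw [h1]; exact e.map_source hq
    apply Subtype.ext
    show (σ q.1.2).1 = q.1
    rw [hσ _ h2, h1, e.left_inv hq]
  · intro h hh
    show (σ h).1.2 = h
    rw [hσ h hh]
  · exact (continuous_snd.comp continuous_subtype_val : Continuous 𝒢.face₀).continuousOn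
  · have hi : IsInducing (Subtype.val : 𝒢.Composable → G × G) := IsInducing.subtypeVal
    rw [hi.continuousOn_iff]
    have hc : ContinuousOn (fun h => (e.symm (𝒢.rng h), h)) {h | 𝒢.rng h ∈ e.target} :=
      (e.continuousOn_symm.comp hr.continuousOn fun _ hh => hh).prodMk continuousOn_id
    exact hc.congr fun h hh => hσ h hh
  · have hc : Continuous fun q : 𝒢.Composable => q.1.1 :=
      continuous_fst.comp continuous_subtype_val
    exact e.open_source.preimage hc
  · exact e.open_target.preimage hr

theorem isLocalHomeomorph_face₁ : IsLocalHomeomorph 𝒢.face₁ := by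
  refine IsLocalHomeomorph.of_comp (g := 𝒢.src) ?_ 𝒢.isLocalHomeomorph_src
    (continuousOn_iff_continuous_domRestrict.mp 𝒢.continuous_mul)
  have h : 𝒢.src ∘ 𝒢.face₁ = 𝒢.src ∘ 𝒢.face₀ := funext fun p => 𝒢.src_mul _ _ p.2
  rw [h]
  exact 𝒢.isLocalHomeomorph_src.comp 𝒢.isLocalHomeomorph_face₀

theorem isLocalHomeomorph_face₂ : IsLocalHomeomorph 𝒢.face₂ := by
  refine IsLocalHomeomorph.of_comp (g := 𝒢.src) ?_ 𝒢.isLocalHomeomorph_src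
    (continuous_fst.comp continuous_subtype_val)
  have h : 𝒢.src ∘ 𝒢.face₂ = 𝒢.rng ∘ 𝒢.face₀ := funext fun p => p.2
  rw [h]
  exact 𝒢.isLocalHomeomorph_rng.comp 𝒢.isLocalHomeomorph_face₀

/-! ### The first homology group -/

/-- `δ₁ = s_* - r_* : C_c(G, ℤ) → C_c(G^(0), ℤ)`. -/
def δ₁ : C_c(G, ℤ) →+ C_c(X, ℤ) :=
  haveI := 𝒢.t2Space_units
  pushforward 𝒢.src 𝒢.isLocalHomeomorph_src - pushforward 𝒢.rng 𝒢.isLocalHomeomorph_rng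

/-- `δ₂ = d₀_* - d₁_* + d₂_* : C_c(G^(2), ℤ) → C_c(G, ℤ)`. -/
def δ₂ : C_c(𝒢.Composable, ℤ) →+ C_c(G, ℤ) :=
  pushforward 𝒢.face₀ 𝒢.isLocalHomeomorph_face₀ - pushforward 𝒢.face₁ 𝒢.isLocalHomeomorph_face₁
    + pushforward 𝒢.face₂ 𝒢.isLocalHomeomorph_face₂

theorem δ₁_δ₂ (f : C_c(𝒢.Composable, ℤ)) : 𝒢.δ₁ (𝒢.δ₂ f) = 0 := by
  have := 𝒢.t2Space_units
  have hs := 𝒢.isLocalHomeomorph_src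
  have hr := 𝒢.isLocalHomeomorph_rng
  have hs0 := hs.comp 𝒢.isLocalHomeomorph_face₀
  have hr0 := hr.comp 𝒢.isLocalHomeomorph_face₀
  have hr2 := hr.comp 𝒢.isLocalHomeomorph_face₂
  simp only [δ₁, δ₂, AddMonoidHom.sub_apply, AddMonoidHom.add_apply, map_sub, map_add]
  rw [pushforward_comp _ 𝒢.isLocalHomeomorph_face₀ _ hs _ hs0 fun _ => rfl,
    pushforward_comp _ 𝒢.isLocalHomeomorph_face₁ _ hs _ hs0 fun p => 𝒢.src_mul _ _ p.2,
    pushforward_comp _ 𝒢.isLocalHomeomorph_face₂ _ hs _ hr0 fun p => p.2,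
    pushforward_comp _ 𝒢.isLocalHomeomorph_face₀ _ hr _ hr0 fun _ => rfl,
    pushforward_comp _ 𝒢.isLocalHomeomorph_face₁ _ hr _ hr2 fun p => 𝒢.rng_mul _ _ p.2,
    pushforward_comp _ 𝒢.isLocalHomeomorph_face₂ _ hr _ hr2 fun _ => rfl]
  abel

/-- `δ₂` as a homomorphism into `ker δ₁`. -/
def δ₂ker : C_c(𝒢.Composable, ℤ) →+ 𝒢.δ₁.ker :=
  𝒢.δ₂.codRestrict 𝒢.δ₁.ker fun f => AddMonoidHom.mem_ker.mpr (𝒢.δ₁_δ₂ f)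

/-- The homology group `H₁(G) = ker δ₁ / im δ₂`, with integer coefficients. -/
abbrev H₁ : Type u := 𝒢.δ₁.ker ⧸ 𝒢.δ₂ker.range

/-! ### The topological full group and the index map -/

/-- A `G`-set: a subset of `G` on which the source and range maps are injective. -/
def IsGSet (U : Set G) : Prop := InjOn 𝒢.src U ∧ InjOn 𝒢.rng U

/-- For a `G`-set `U`, the assertion `γ = τ_U`, where `τ_U = r ∘ (s|U)⁻¹ : s(U) → r(U)`. -/
def IsTau (U : Set G) (γ : X ≃ₜ X) : Prop :=
  𝒢.src '' U = univ ∧ 𝒢.rng '' U = univ ∧ ∀ g ∈ U, γ (𝒢.src g) = 𝒢.rng g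

/-- `U` is a compact open `G`-set with `γ = τ_U`. -/
structure Represents (U : Set G) (γ : X ≃ₜ X) : Prop where
  isOpen : IsOpen U
  isCompact : IsCompact U
  isGSet : 𝒢.IsGSet U
  isTau : 𝒢.IsTau U γ

variable {𝒢} in
theorem Represents.one [CompactSpace X] : 𝒢.Represents (range 𝒢.unit) 1 where
  isOpen := 𝒢.isOpenEmbedding_unit.isOpen_range
  isCompact := isCompact_range 𝒢.continuous_unit
  isGSet := by
    constructor
    · rintro _ ⟨x, rfl⟩ _ ⟨y, rfl⟩ h
      rw [𝒢.src_unit, 𝒢.src_unit] at h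
      rw [h]
    · rintro _ ⟨x, rfl⟩ _ ⟨y, rfl⟩ h
      rw [𝒢.rng_unit, 𝒢.rng_unit] at h
      rw [h]
  isTau := by
    refine ⟨eq_univ_of_forall fun x => ⟨_, ⟨x, rfl⟩, 𝒢.src_unit x⟩,
      eq_univ_of_forall fun x => ⟨_, ⟨x, rfl⟩, 𝒢.rng_unit x⟩, ?_⟩
    rintro _ ⟨x, rfl⟩
    rw [𝒢.src_unit, 𝒢.rng_unit]
    rfl

variable {𝒢} in
theorem Represents.inv {U : Set G} {γ : X ≃ₜ X} (h : 𝒢.Represents U γ) :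
    𝒢.Represents (𝒢.inv ⁻¹' U) γ⁻¹ where
  isOpen := h.isOpen.preimage 𝒢.continuous_inv
  isCompact := by
    have : 𝒢.inv ⁻¹' U = 𝒢.inv '' U := by
      ext g
      exact ⟨fun hg => ⟨_, hg, 𝒢.inv_inv g⟩, by rintro ⟨k, hk, rfl⟩; simpa [𝒢.inv_inv] using hk⟩
    rw [this]
    exact h.isCompact.image 𝒢.continuous_inv
  isGSet := by
    constructor
    · intro a ha b hb hab
      rw [← 𝒢.rng_inv a, ← 𝒢.rng_inv b] at hab
      rw [← 𝒢.inv_inv a, ← 𝒢.inv_inv b, h.isGSet.2 ha hb hab]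
    · intro a ha b hb hab
      rw [← 𝒢.src_inv a, ← 𝒢.src_inv b] at hab
      rw [← 𝒢.inv_inv a, ← 𝒢.inv_inv b, h.isGSet.1 ha hb hab]
  isTau := by
    refine ⟨eq_univ_of_forall fun x => ?_, eq_univ_of_forall fun x => ?_, fun g hg => ?_⟩
    · obtain ⟨g, hg, rfl⟩ : x ∈ 𝒢.rng '' U := h.isTau.2.1 ▸ mem_univ x
      exact ⟨𝒢.inv g, by simpa [𝒢.inv_inv] using hg, 𝒢.src_inv g⟩
    · obtain ⟨g, hg, rfl⟩ : x ∈ 𝒢.src '' U := h.isTau.1 ▸ mem_univ x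
      exact ⟨𝒢.inv g, by simpa [𝒢.inv_inv] using hg, 𝒢.rng_inv g⟩
    · have := h.isTau.2.2 _ hg
      rw [𝒢.src_inv, 𝒢.rng_inv] at this
      show γ.symm (𝒢.src g) = 𝒢.rng g
      rw [← this, γ.symm_apply_apply]

/-- The product `U V = {g h | g ∈ U, h ∈ V, s(g) = r(h)}` of two subsets of `G`. -/
def setMul (U V : Set G) : Set G := 𝒢.face₁ '' {p | p.1.1 ∈ U ∧ p.1.2 ∈ V}

theorem isOpen_setMul {U V : Set G} (hU : IsOpen U) (hV : IsOpen V) :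
    IsOpen (𝒢.setMul U V) :=
  𝒢.isLocalHomeomorph_face₁.isOpenMap _
    ((hU.preimage (continuous_fst.comp continuous_subtype_val)).inter
      (hV.preimage (continuous_snd.comp continuous_subtype_val)))

theorem isCompact_setMul {U V : Set G} (hU : IsCompact U) (hV : IsCompact V) :
    IsCompact (𝒢.setMul U V) := by
  have := 𝒢.t2Space_units
  refine IsCompact.image ?_ 𝒢.isLocalHomeomorph_face₁.continuous
  have hcl : IsClosed {p : G × G | 𝒢.src p.1 = 𝒢.rng p.2} :=
    isClosed_eq (𝒢.isLocalHomeomorph_src.continuous.comp continuous_fst)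
      (𝒢.isLocalHomeomorph_rng.continuous.comp continuous_snd)
  exact hcl.isClosedEmbedding_subtypeVal.isCompact_preimage (hU.prod hV)

variable {𝒢} in
theorem Represents.mul {U V : Set G} {γ η : X ≃ₜ X} (hU : 𝒢.Represents U γ)
    (hV : 𝒢.Represents V η) : 𝒢.Represents (𝒢.setMul U V) (γ * η) where
  isOpen := 𝒢.isOpen_setMul hU.isOpen hV.isOpen
  isCompact := 𝒢.isCompact_setMul hU.isCompact hV.isCompact
  isGSet := by
    constructor
    · rintro _ ⟨⟨⟨a, b⟩, hab⟩, ⟨ha, hb⟩, rfl⟩ _ ⟨⟨⟨c, d⟩, hcd⟩, ⟨hc, hd⟩, rfl⟩ h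
      dsimp only [face₁] at *
      rw [𝒢.src_mul _ _ hab, 𝒢.src_mul _ _ hcd] at h
      have h1 := hV.isGSet.1 hb hd h
      subst h1
      rw [hU.isGSet.1 ha hc (hab.trans hcd.symm)]
    · rintro _ ⟨⟨⟨a, b⟩, hab⟩, ⟨ha, hb⟩, rfl⟩ _ ⟨⟨⟨c, d⟩, hcd⟩, ⟨hc, hd⟩, rfl⟩ h
      dsimp only [face₁] at *
      rw [𝒢.rng_mul _ _ hab, 𝒢.rng_mul _ _ hcd] at h
      have h1 := hU.isGSet.2 ha hc h
      subst h1
      rw [hV.isGSet.2 hb hd (hab.symm.trans hcd)]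
  isTau := by
    refine ⟨eq_univ_of_forall fun x => ?_, eq_univ_of_forall fun x => ?_, ?_⟩
    · obtain ⟨b, hb, rfl⟩ : x ∈ 𝒢.src '' V := hV.isTau.1 ▸ mem_univ x
      obtain ⟨a, ha, hab⟩ : 𝒢.rng b ∈ 𝒢.src '' U := hU.isTau.1 ▸ mem_univ _
      exact ⟨_, ⟨⟨(a, b), hab⟩, ⟨ha, hb⟩, rfl⟩, 𝒢.src_mul _ _ hab⟩
    · obtain ⟨a, ha, rfl⟩ : x ∈ 𝒢.rng '' U := hU.isTau.2.1 ▸ mem_univ x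
      obtain ⟨b, hb, hab⟩ : 𝒢.src a ∈ 𝒢.rng '' V := hV.isTau.2.1 ▸ mem_univ _
      exact ⟨_, ⟨⟨(a, b), hab.symm⟩, ⟨ha, hb⟩, rfl⟩, 𝒢.rng_mul _ _ hab.symm⟩
    · rintro _ ⟨⟨⟨a, b⟩, hab⟩, ⟨ha, hb⟩, rfl⟩
      dsimp only [face₁] at *
      rw [𝒢.src_mul _ _ hab, 𝒢.rng_mul _ _ hab]
      show γ (η (𝒢.src b)) = 𝒢.rng a
      rw [hV.isTau.2.2 b hb, ← hab, hU.isTau.2.2 a ha]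

/-- The topological full group `[[G]]`: the homeomorphisms of the (compact) unit space of the
form `τ_U` for a compact open `G`-set `U`. -/
def topFullGroup [CompactSpace X] : Subgroup (X ≃ₜ X) where
  carrier := {γ | ∃ U, 𝒢.Represents U γ}
  one_mem' := ⟨_, Represents.one⟩
  mul_mem' := by
    rintro _ _ ⟨U, hU⟩ ⟨V, hV⟩
    exact ⟨_, hU.mul hV⟩
  inv_mem' := by
    rintro _ ⟨U, hU⟩
    exact ⟨_, hU.inv⟩

/-- `G` is essentially principal: the interior of the isotropy bundle
`{g | r(g) = s(g)}` is the unit space. -/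
def EssentiallyPrincipal : Prop := interior {g | 𝒢.rng g = 𝒢.src g} = range 𝒢.unit

theorem eq_of_inv_mul_eq_unit {g h : G} (hr : 𝒢.rng g = 𝒢.rng h) {x : X}
    (hx : 𝒢.mul (𝒢.inv g) h = 𝒢.unit x) : g = h := by
  have hc : 𝒢.src (𝒢.inv g) = 𝒢.rng h := by rw [𝒢.src_inv, hr]
  have hs : x = 𝒢.src g := by
    rw [← 𝒢.rng_unit x, ← hx, 𝒢.rng_mul _ _ hc, 𝒢.rng_inv]
  have h1 := 𝒢.mul_assoc g (𝒢.inv g) h (𝒢.rng_inv g).symm hc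
  rw [𝒢.mul_inv, hr, 𝒢.unit_mul, hx, hs, 𝒢.mul_unit] at h1
  exact h1.symm

variable {𝒢} in
theorem Represents.subset {U V : Set G} {γ : X ≃ₜ X} (hG : 𝒢.EssentiallyPrincipal)
    (hU : 𝒢.Represents U γ) (hV : 𝒢.Represents V γ) : U ⊆ V := by
  intro g hg
  obtain ⟨h, hh, hgh⟩ : 𝒢.src g ∈ 𝒢.src '' V := hV.isTau.1 ▸ mem_univ _
  have key : ∀ a b, a ∈ U → b ∈ V → (𝒢.src a = 𝒢.src b ↔ 𝒢.rng a = 𝒢.rng b) := by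
    intro a b ha hb
    rw [← hU.isTau.2.2 a ha, ← hV.isTau.2.2 b hb, γ.injective.eq_iff]
  have hsub : 𝒢.setMul (𝒢.inv ⁻¹' U) V ⊆ {g | 𝒢.rng g = 𝒢.src g} := by
    rintro _ ⟨⟨⟨a, b⟩, hab⟩, ⟨ha, hb⟩, rfl⟩
    dsimp only [face₁] at *
    show 𝒢.rng (𝒢.mul a b) = 𝒢.src (𝒢.mul a b)
    rw [𝒢.rng_mul _ _ hab, 𝒢.src_mul _ _ hab, ← 𝒢.src_inv a]
    refine (key _ _ ha hb).mpr ?_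
    rw [𝒢.rng_inv, hab]
  have hint := interior_maximal hsub
    (𝒢.isOpen_setMul (hU.isOpen.preimage 𝒢.continuous_inv) hV.isOpen)
  rw [hG] at hint
  have hr : 𝒢.rng g = 𝒢.rng h := (key _ _ hg hh).mp hgh.symm
  have hc : 𝒢.src (𝒢.inv g) = 𝒢.rng h := by rw [𝒢.src_inv, hr]
  have hmem : 𝒢.mul (𝒢.inv g) h ∈ 𝒢.setMul (𝒢.inv ⁻¹' U) V :=
    ⟨⟨(𝒢.inv g, h), hc⟩, ⟨by simpa [𝒢.inv_inv] using hg, hh⟩, rfl⟩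
  obtain ⟨x, hx⟩ := hint hmem
  rw [𝒢.eq_of_inv_mul_eq_unit hr hx.symm]
  exact hh

/-- If `G` is essentially principal, every `γ ∈ [[G]]` is `τ_U` for a unique compact open
`G`-set `U`. -/
theorem existsUnique_represents [CompactSpace X] (hG : 𝒢.EssentiallyPrincipal)
    (γ : 𝒢.topFullGroup) : ∃! U, 𝒢.Represents U γ.1 := by
  obtain ⟨U, hU⟩ := γ.2
  exact ⟨U, hU, fun V hV => (hV.subset hG hU).antisymm (hU.subset hG hV)⟩

variable {𝒢} in
theorem Represents.charFn_mem_ker {U : Set G} {γ : X ≃ₜ X} (h : 𝒢.Represents U γ) :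
    charFn U h.isOpen h.isCompact ∈ 𝒢.δ₁.ker := by
  have := 𝒢.t2Space_units
  rw [AddMonoidHom.mem_ker]
  ext x
  show pushforward 𝒢.src _ _ x - pushforward 𝒢.rng _ _ x = 0
  rw [pushforward_charFn _ _ _ _ h.isGSet.1 h.isTau.1,
    pushforward_charFn _ _ _ _ h.isGSet.2 h.isTau.2.1, sub_self]

variable {𝒢} in
/-- The class `[1_U] ∈ H₁(G)` of a compact open `G`-set `U` with `τ_U = γ ∈ [[G]]`. -/
def Represents.homologyClass {U : Set G} {γ : X ≃ₜ X} (h : 𝒢.Represents U γ) : 𝒢.H₁ :=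
  QuotientAddGroup.mk ⟨charFn U h.isOpen h.isCompact, h.charFn_mem_ker⟩

/-- The index map `I : [[G]] → H₁(G)`, `I(τ_U) = [1_U]`, of an essentially principal étale
groupoid with compact unit space. -/
def indexMap [CompactSpace X] (hG : 𝒢.EssentiallyPrincipal) (γ : 𝒢.topFullGroup) : 𝒢.H₁ :=
  Represents.homologyClass (𝒢.existsUnique_represents hG γ).choose_spec.1

/-! ### Almost finite groupoids -/

/-- Elementary subgroupoids: compact open principal subgroupoids with the same unit space. -/
structure IsElementary (K : Set G) : Prop where
  isCompact : IsCompact K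
  isOpen : IsOpen K
  unit_mem : ∀ x, 𝒢.unit x ∈ K
  inv_mem : ∀ g ∈ K, 𝒢.inv g ∈ K
  mul_mem : ∀ g ∈ K, ∀ h ∈ K, 𝒢.src g = 𝒢.rng h → 𝒢.mul g h ∈ K
  principal : ∀ g ∈ K, 𝒢.rng g = 𝒢.src g → g ∈ range 𝒢.unit

/-- `K x = {g ∈ K | s(g) = x}`, for `K ⊆ G` and a unit `x`. -/
def sourceFiber (K : Set G) (x : X) : Set G := {g ∈ K | 𝒢.src g = x}

/-- The orbit `K(x) = r(K x)`. -/
def orbit (K : Set G) (x : X) : Set X := 𝒢.rng '' 𝒢.sourceFiber K x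

/-- `G` is almost finite: for all compact `C ⊆ G` and `ε > 0` there is an elementary
subgroupoid `K` with `|C K x \ K x| / |K(x)| < ε` for all units `x`. (The sets `C K x` and `K(x)`
are finite, and `K(x)` is nonempty.) -/
def AlmostFinite : Prop :=
  ∀ C : Set G, IsCompact C → ∀ ε : ℝ, 0 < ε → ∃ K : Set G, 𝒢.IsElementary K ∧
    ∀ x : X, ((𝒢.setMul C (𝒢.sourceFiber K x) \ 𝒢.sourceFiber K x).ncard : ℝ) /
      ((𝒢.orbit K x).ncard : ℝ) < ε

end EtaleGroupoid

end

/-!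
Let `f` be a cycle. Adding the boundary `|f| + inv_* |f|` makes it nonnegative
(`exists_nonneg_chainClass_eq`), so that `f` is a finite family of arrows in which every unit is the
source of as many arrows as it is the range of. Almost finiteness gives an elementary subgroupoid
`K` so invariant under the support of `f` that fewer arrows of the family leave a `K`-orbit, without
lying in `K`, than the orbit has points (`IsElementary.ncard_leaving_le`). As `f` is a cycle, as
many enter as leave. The arrows outside `K` can therefore be multiplied by elements of `K` on both
sides so that in each orbit their sources become distinct, their ranges become distinct, and the
same points occur as sources and as ranges. Together with the units at the other points, they then
form a compact open `G`-set `U` with source and range `X`, hence an element of `[[G]]`.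

The choices must be continuous. Since `K` is compact and principal, there is a continuous section
`t : X → K` of the source map such that `r (t x)` depends only on the `K`-orbit of `x`
(`IsElementary.exists_section`), so `μ = r ∘ t` is a local homeomorphism whose fibres are the orbits.
New sources and ranges are found by lifting local homeomorphisms into `X` through `μ`. Such lifts
exist when the fibres are small enough: fibres are ranked by locally constant functions and points
of equal rank are matched (`exists_continuous_injective_lift`).

In homology, products of arrows become sums (`chainClass_mul`), and unit arrows vanish. So
conjugation by `t` changes the class of a chain `F` by `-t_* (δ₁ F)`, that is, not at all if `F`
is a cycle (`chainClass_conjugate`), and it maps `K` to units. Hence `f` is homologous to the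
conjugates of its arrows outside `K`. These differ from the arrows of `U` by the arrows `t` at the
new sources and at the new ranges, whose contributions cancel since the two sets agree
(`exists_represents_of_matching`).
-/

open Set Topology
open scoped CompactlySupported

noncomputable section

/-! ### Separating compact sets of pairs by locally constant functions -/

section Separation

/-- The local version, a clopen set separating the two points, patches over a compact set because
finitely many `ℕ`-valued functions combine into one by `Nat.pair`. -/
theorem exists_continuous_nat_separating {Z : Type*} [TopologicalSpace Z] [CompactSpace Z]
    [T2Space Z] [TotallyDisconnectedSpace Z] {D : Set (Z × Z)} (hD : IsCompact D)
    (hne : ∀ p ∈ D, p.1 ≠ p.2) :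
    ∃ ψ : Z → ℕ, Continuous ψ ∧ ∀ p ∈ D, ψ p.1 ≠ ψ p.2 := by
  classical
  refine hD.induction_on (p := fun S => ∃ ψ : Z → ℕ, Continuous ψ ∧ ∀ p ∈ S, ψ p.1 ≠ ψ p.2)
    ⟨fun _ => 0, continuous_const, by simp⟩ ?_ ?_ ?_
  · rintro S T hST ⟨ψ, hc, hψ⟩
    exact ⟨ψ, hc, fun p hp => hψ p (hST hp)⟩
  · rintro S T ⟨ψ, hc, hψ⟩ ⟨ψ', hc', hψ'⟩
    refine ⟨fun z => Nat.pair (ψ z) (ψ' z), ?_, ?_⟩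
    · exact (continuous_of_discreteTopology (f := fun q : ℕ × ℕ => Nat.pair q.1 q.2)).comp
        (hc.prodMk hc')
    · rintro p (hp | hp) h
      · exact hψ p hp (Nat.pair_eq_pair.mp h).1
      · exact hψ' p hp (Nat.pair_eq_pair.mp h).2
  · intro p hp
    obtain ⟨B, hB, h1, h2⟩ := exists_isClopen_of_totally_separated (hne p hp)
    refine ⟨B ×ˢ Bᶜ, mem_nhdsWithin_of_mem_nhds
      ((hB.isOpen.prod hB.compl.isOpen).mem_nhds ⟨h1, h2⟩),
      B.indicator fun _ => 1, ?_, ?_⟩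
    · exact continuous_const.indicator fun a ha => by
        rw [hB.frontier_eq] at ha; exact ha.elim
    · rintro q ⟨hq1, hq2⟩
      rw [indicator_of_mem hq1, indicator_of_notMem hq2]
      exact one_ne_zero

theorem totallyDisconnectedSpace_of_isLocalHomeomorph {E X : Type*} [TopologicalSpace E]
    [TopologicalSpace X] [T2Space E] [TotallyDisconnectedSpace X] {p : E → X}
    (hp : IsLocalHomeomorph p) : TotallyDisconnectedSpace E := by
  refine ⟨fun S _ hS => ?_⟩
  have hsub : (p '' S).Subsingleton :=
    (hS.image p hp.continuous.continuousOn).subsingleton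
  intro a ha b hb
  refine (T2Space.isSeparatedMap p).constOn_of_comp hp.isLocallyInjective hS continuousOn_id
    (fun c hc d hd => ?_) ha hb
  exact hsub (mem_image_of_mem _ hc) (mem_image_of_mem _ hd)

theorem IsLocalHomeomorph.isCompact_offDiag_fiberProduct {E Y : Type*} [TopologicalSpace E]
    [TopologicalSpace Y] [CompactSpace E] [T2Space Y] {π : E → Y} (hπ : IsLocalHomeomorph π) :
    IsCompact {p : E × E | π p.1 = π p.2 ∧ p.1 ≠ p.2} := by
  have hcl : IsClosed {p : E × E | π p.1 = π p.2 ∧ p.1 ≠ p.2} := by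
    rw [← isOpen_compl_iff, isOpen_iff_mem_nhds]
    rintro ⟨a, b⟩ hab
    by_cases h : π a = π b
    · obtain rfl : a = b := by
        by_contra hne; exact hab ⟨h, hne⟩
      obtain ⟨U, hU, haU, hi⟩ := hπ.isLocallyInjective a
      filter_upwards [(hU.prod hU).mem_nhds ⟨haU, haU⟩] with q hq
      exact fun hq' => hq'.2 (hi hq.1 hq.2 hq'.1)
    · have ho : IsOpen {p : E × E | π p.1 ≠ π p.2} :=
        (isClosed_eq (hπ.continuous.comp continuous_fst)
          (hπ.continuous.comp continuous_snd)).isOpen_compl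
      filter_upwards [ho.mem_nhds (x := (a, b)) h] with q hq
      exact fun hq' => hq hq'.1
  exact hcl.isCompact

theorem IsLocalHomeomorph.exists_continuous_nat_injOn_fiber {E Y : Type*} [TopologicalSpace E]
    [TopologicalSpace Y] [CompactSpace E] [T2Space E] [TotallyDisconnectedSpace E] [T2Space Y]
    {π : E → Y} (hπ : IsLocalHomeomorph π) :
    ∃ ψ : E → ℕ, Continuous ψ ∧ ∀ y, InjOn ψ (π ⁻¹' {y}) := by
  obtain ⟨ψ, hc, hψ⟩ := exists_continuous_nat_separating hπ.isCompact_offDiag_fiberProduct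
    (fun p hp => hp.2)
  refine ⟨ψ, hc, fun y a ha b hb hab => ?_⟩
  by_contra hne
  exact hψ (a, b) ⟨(show π a = y from ha).trans (show π b = y from hb).symm, hne⟩ hab

end Separation

/-! ### Pushforwards of characteristic functions -/

section PushforwardCharFn

variable {X Y : Type*} [TopologicalSpace X] [TopologicalSpace Y] [T2Space X] [T2Space Y]

theorem charFn_apply {U : Set X} (ho : IsOpen U) (hc : IsCompact U) (x : X) :
    charFn U ho hc x = U.indicator (fun _ => (1 : ℤ)) x := rfl

theorem pushforward_charFn_eq_ncard (p : X → Y) (hp : IsLocalHomeomorph p) {U : Set X}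
    (ho : IsOpen U) (hc : IsCompact U) (y : Y) :
    pushforward p hp (charFn U ho hc) y = ((p ⁻¹' {y} ∩ U).ncard : ℤ) := by
  have hfin := finite_fiber_inter hp hc y
  have hsupp : Function.support (charFn U ho hc) = U := by
    ext x
    simp [charFn_apply, Function.mem_support]
  rw [pushforward_apply, ← finsum_mem_inter_support, hsupp, finsum_mem_congr rfl
    (g := fun _ => (1 : ℤ)) fun x hx => (charFn_apply ho hc x).trans (indicator_of_mem hx.2 _),
    finsum_mem_eq_finite_toFinset_sum _ hfin, ncard_eq_toFinset_card _ hfin]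
  simp

theorem pushforward_charFn_of_injective (p : X → Y) (hp : IsLocalHomeomorph p)
    (hi : Function.Injective p) {U : Set X} (ho : IsOpen U) (hc : IsCompact U)
    (ho' : IsOpen (p '' U)) (hc' : IsCompact (p '' U)) :
    pushforward p hp (charFn U ho hc) = charFn (p '' U) ho' hc' := by
  ext y
  rw [pushforward_charFn_eq_ncard, charFn_apply]
  by_cases hy : y ∈ p '' U
  · obtain ⟨x, hx, rfl⟩ := hy
    have : p ⁻¹' {p x} ∩ U = {x} := by
      ext z
      simp only [mem_inter_iff, mem_preimage, mem_singleton_iff, hi.eq_iff]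
      exact ⟨fun h => h.1, by rintro rfl; exact ⟨rfl, hx⟩⟩
    rw [this, indicator_of_mem (mem_image_of_mem p hx)]
    simp
  · have : p ⁻¹' {y} ∩ U = ∅ := by
      ext z
      simp only [mem_inter_iff, mem_preimage, mem_singleton_iff, mem_empty_iff_false, iff_false]
      rintro ⟨rfl, hz⟩
      exact hy ⟨z, hz, rfl⟩
    rw [this, indicator_of_notMem hy]
    simp

theorem pushforward_congr (p q : X → Y) (hp : IsLocalHomeomorph p) (hq : IsLocalHomeomorph q)
    {f : C_c(X, ℤ)} (h : ∀ x, f x ≠ 0 → p x = q x) :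
    pushforward p hp f = pushforward q hq f := by
  ext y
  rw [pushforward_apply, pushforward_apply, ← finsum_mem_inter_support,
    ← finsum_mem_inter_support (⇑f) (q ⁻¹' {y})]
  congr 1
  ext x
  have : x ∈ p ⁻¹' {y} ∩ Function.support f ↔ x ∈ q ⁻¹' {y} ∩ Function.support f := by
    simp only [mem_inter_iff, mem_preimage, mem_singleton_iff, Function.mem_support]
    constructor
    · rintro ⟨h1, h2⟩; exact ⟨(h x h2) ▸ h1, h2⟩
    · rintro ⟨h1, h2⟩; exact ⟨(h x h2).symm ▸ h1, h2⟩
  simp only [this]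

theorem pushforward_mono (p : X → Y) (hp : IsLocalHomeomorph p) {f g : C_c(X, ℤ)}
    (h : ∀ x, f x ≤ g x) (y : Y) : pushforward p hp f y ≤ pushforward p hp g y := by
  rw [← sub_nonneg]
  have : pushforward p hp g y - pushforward p hp f y = pushforward p hp (g - f) y := by
    rw [map_sub]; rfl
  rw [this, pushforward_apply]
  refine finsum_nonneg fun x => finsum_nonneg fun _ => ?_
  exact sub_nonneg.mpr (h x)

theorem pushforward_eq_self_of_fixed (p : X → X) (hp : IsLocalHomeomorph p) (h : ∀ x, p x = x)
    (f : C_c(X, ℤ)) : pushforward p hp f = f := by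
  ext y
  rw [pushforward_apply]
  have : p ⁻¹' {y} = {y} := by ext x; simp [h]
  rw [this, finsum_mem_singleton]

end PushforwardCharFn

/-- The characteristic function of a compact space. -/
abbrev oneFn (E : Type*) [TopologicalSpace E] [CompactSpace E] [T2Space E] : C_c(E, ℤ) :=
  charFn univ isOpen_univ isCompact_univ

theorem pushforward_oneFn {E Y : Type*} [TopologicalSpace E] [CompactSpace E] [T2Space E]
    [TopologicalSpace Y] [T2Space Y] (p : E → Y) (hp : IsLocalHomeomorph p) (y : Y) :
    pushforward p hp (oneFn E) y = ((p ⁻¹' {y}).ncard : ℤ) := by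
  rw [pushforward_charFn_eq_ncard, inter_univ]

theorem IsLocalHomeomorph.finite_fiber {E Y : Type*} [TopologicalSpace E] [CompactSpace E]
    [TopologicalSpace Y] [T1Space Y] {p : E → Y} (hp : IsLocalHomeomorph p) (y : Y) :
    (p ⁻¹' {y}).Finite := by
  simpa using finite_fiber_inter hp isCompact_univ y

/-! ### Matching the fibres of two local homeomorphisms -/

section Matching

/-- The rank of `e` in its fibre under `π`, where fibres are ordered by `ψ`. -/
def fiberRank {E Y : Type*} (π : E → Y) (ψ : E → ℕ) (e : E) : ℕ :=
  (π ⁻¹' {π e} ∩ {e' | ψ e' < ψ e}).ncard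

/-- Counting initial segments of the fibres is a pushforward, hence locally constant. -/
theorem continuous_fiberRank {E Y : Type*} [TopologicalSpace E] [CompactSpace E] [T2Space E]
    [TopologicalSpace Y] [T2Space Y] {π : E → Y} (hπ : IsLocalHomeomorph π) {ψ : E → ℕ}
    (hψ : Continuous ψ) : Continuous (fiberRank π ψ) := by
  have hcl : ∀ m, IsClopen {e | ψ e < m} := fun m =>
    (isClopen_discrete (Iio m)).preimage hψ
  rw [continuous_iff_continuousAt]
  intro e
  have h1 : Continuous fun e' => pushforward π hπ
      (charFn _ (hcl (ψ e)).isOpen (hcl (ψ e)).isClosed.isCompact) (π e') :=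
    (pushforward π hπ _).continuous.comp hπ.continuous
  have h2 : ∀ᶠ e' in 𝓝 e, ψ e' = ψ e :=
    hψ.continuousAt.eventually (isOpen_discrete {ψ e} |>.mem_nhds rfl)
  have h3 : ContinuousAt (fun e' => (fiberRank π ψ e' : ℤ)) e := by
    refine h1.continuousAt.congr ?_
    filter_upwards [h2] with e' he'
    rw [pushforward_charFn_eq_ncard, fiberRank, he']
  have h4 := (continuous_of_discreteTopology (f := Int.toNat)).continuousAt.comp h3
  exact h4.congr (Filter.Eventually.of_forall fun e' => Int.toNat_natCast _)

theorem Finset.exists_card_filter_lt_eq {α : Type*} [DecidableEq α] (T : Finset α) (ψ : α → ℕ)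
    (hψ : InjOn ψ T) {j : ℕ} (hj : j < T.card) :
    ∃ a ∈ T, (T.filter fun b => ψ b < ψ a).card = j := by
  induction T using Finset.induction_on_max_value ψ generalizing j with
  | empty => simp at hj
  | insert a s ha hmax ih =>
    have hlt : ∀ b ∈ s, ψ b < ψ a := fun b hb => lt_of_le_of_ne (hmax b hb) fun h =>
      ha (hψ (by simp [hb]) (by simp) h ▸ hb)
    rw [Finset.card_insert_of_notMem ha, Nat.lt_succ_iff_lt_or_eq] at hj
    rcases hj with hj | rfl
    · obtain ⟨b, hb, hbj⟩ := ih (hψ.mono (by simp)) hj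
      refine ⟨b, Finset.mem_insert_of_mem hb, ?_⟩
      rw [Finset.filter_insert, if_neg (hlt b hb).not_gt, hbj]
    · refine ⟨a, Finset.mem_insert_self _ _, ?_⟩
      rw [Finset.filter_insert, if_neg (lt_irrefl _), Finset.filter_true_of_mem hlt]

theorem exists_fiberRank_eq {E Y : Type*} {π : E → Y} {ψ : E → ℕ} {y : Y}
    (hψ : InjOn ψ (π ⁻¹' {y})) {j : ℕ} (hj : j < (π ⁻¹' {y}).ncard) :
    ∃ e, π e = y ∧ fiberRank π ψ e = j := by
  classical
  have hfin : (π ⁻¹' {y}).Finite := finite_of_ncard_pos (by omega)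
  obtain ⟨e, he, hej⟩ := hfin.toFinset.exists_card_filter_lt_eq ψ (by simpa using hψ)
    (by rwa [← ncard_eq_toFinset_card _ hfin])
  have hey : π e = y := by simpa using he
  refine ⟨e, hey, ?_⟩
  rw [← hej, fiberRank, hey, ← ncard_coe_finset]
  congr 1
  ext b
  simp

theorem fiberRank_lt_ncard {E Y : Type*} {π : E → Y} {ψ : E → ℕ} {e : E}
    (hfin : (π ⁻¹' {π e}).Finite) : fiberRank π ψ e < (π ⁻¹' {π e}).ncard := by
  refine ncard_lt_ncard ⟨inter_subset_left, fun h => ?_⟩ hfin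
  exact lt_irrefl (ψ e) (h (show e ∈ π ⁻¹' {π e} from rfl)).2

theorem injOn_fiberRank {E Y : Type*} {π : E → Y} {ψ : E → ℕ} {y : Y}
    (hfin : (π ⁻¹' {y}).Finite) (hψ : InjOn ψ (π ⁻¹' {y})) :
    InjOn (fiberRank π ψ) (π ⁻¹' {y}) := by
  have key : ∀ a b, π a = y → π b = y → ψ a < ψ b → fiberRank π ψ a < fiberRank π ψ b := by
    intro a b ha hb hab
    unfold fiberRank
    rw [ha, hb]
    refine ncard_lt_ncard ⟨?_, fun h => ?_⟩ (hfin.subset inter_subset_left)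
    · exact inter_subset_inter_right _ fun c (hc : ψ c < ψ a) => hc.trans hab
    · exact lt_irrefl (ψ a) (h (show a ∈ π ⁻¹' {y} ∩ {e' | ψ e' < ψ b} from ⟨ha, hab⟩)).2
  intro a ha b hb hab
  by_contra hne
  rcases lt_or_gt_of_ne (fun h => hne (hψ ha hb h)) with h | h
  · exact (key a b ha hb h).ne hab
  · exact (key b a hb ha h).ne hab.symm

theorem continuous_of_isClosed_graph_of_compact {E Z : Type*} [TopologicalSpace E]
    [TopologicalSpace Z] [CompactSpace Z] {j : E → Z}
    (h : IsClosed {p : E × Z | p.2 = j p.1}) : Continuous j := by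
  rw [continuous_iff_isClosed]
  intro C hC
  have : j ⁻¹' C = Prod.fst '' ({p : E × Z | p.2 = j p.1} ∩ Prod.snd ⁻¹' C) := by
    ext e
    constructor
    · intro he; exact ⟨(e, j e), ⟨rfl, he⟩, rfl⟩
    · rintro ⟨⟨e', z⟩, ⟨h1, hz⟩, rfl⟩
      have h1 : z = j e' := h1
      exact h1 ▸ hz
  rw [this]
  exact isClosedMap_fst_of_compactSpace _ (h.inter (hC.preimage continuous_snd))

/-- **Matching lemma.** If every fibre of `π` has at most as many points as the corresponding fibre
of `μ`, then `π` lifts through `μ` to a continuous injection. Both families of fibres are ranked by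
locally constant functions, and points of equal rank are matched. -/
theorem exists_continuous_injective_lift {E X Y : Type*} [TopologicalSpace E]
    [TopologicalSpace X] [TopologicalSpace Y] [CompactSpace E] [T2Space E]
    [TotallyDisconnectedSpace E] [CompactSpace X] [T2Space X] [TotallyDisconnectedSpace X]
    [T2Space Y] {π : E → Y} {μ : X → Y} (hπ : IsLocalHomeomorph π) (hμ : IsLocalHomeomorph μ)
    (hle : ∀ y, (π ⁻¹' {y}).ncard ≤ (μ ⁻¹' {y}).ncard) :
    ∃ j : E → X, Continuous j ∧ Function.Injective j ∧ ∀ e, μ (j e) = π e := by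
  obtain ⟨ψ, hψc, hψ⟩ := hπ.exists_continuous_nat_injOn_fiber
  obtain ⟨φ, hφc, hφ⟩ := hμ.exists_continuous_nat_injOn_fiber
  have hex : ∀ e, ∃ x, μ x = π e ∧ fiberRank μ φ x = fiberRank π ψ e := fun e =>
    exists_fiberRank_eq (hφ _) ((fiberRank_lt_ncard (hπ.finite_fiber _)).trans_le (hle _))
  choose j hj hjr using hex
  refine ⟨j, continuous_of_isClosed_graph_of_compact ?_, ?_, hj⟩
  · have : {p : E × X | p.2 = j p.1} =
        {p | μ p.2 = π p.1} ∩ {p | fiberRank μ φ p.2 = fiberRank π ψ p.1} := by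
      ext ⟨e, x⟩
      constructor
      · intro (h : x = j e)
        subst h
        exact ⟨hj e, hjr e⟩
      · rintro ⟨h1, h2⟩
        exact injOn_fiberRank (hμ.finite_fiber _) (hφ _) h1 (hj e) (h2.trans (hjr e).symm)
    rw [this]
    exact (isClosed_eq (hμ.continuous.comp continuous_snd) (hπ.continuous.comp continuous_fst)).inter
      (isClosed_eq ((continuous_fiberRank hμ hφc).comp continuous_snd)
        ((continuous_fiberRank hπ hψc).comp continuous_fst))
  · intro a b hab
    have h1 : π a = π b := by rw [← hj, ← hj, hab]
    have h2 : fiberRank π ψ a = fiberRank π ψ b := by rw [← hjr, ← hjr, hab]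
    exact injOn_fiberRank (hπ.finite_fiber (π b)) (hψ _) h1 rfl h2

theorem exists_continuous_bijective_lift {E F Y : Type*} [TopologicalSpace E]
    [TopologicalSpace F] [TopologicalSpace Y] [CompactSpace E] [T2Space E]
    [TotallyDisconnectedSpace E] [CompactSpace F] [T2Space F] [TotallyDisconnectedSpace F]
    [T2Space Y] {π : E → Y} {μ : F → Y} (hπ : IsLocalHomeomorph π) (hμ : IsLocalHomeomorph μ)
    (heq : ∀ y, (π ⁻¹' {y}).ncard = (μ ⁻¹' {y}).ncard) :
    ∃ j : E → F, Continuous j ∧ Function.Bijective j ∧ ∀ e, μ (j e) = π e := by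
  obtain ⟨j, hjc, hji, hj⟩ := exists_continuous_injective_lift hπ hμ fun y => (heq y).le
  refine ⟨j, hjc, ⟨hji, fun x => ?_⟩, hj⟩
  have hsub : j '' (π ⁻¹' {μ x}) ⊆ μ ⁻¹' {μ x} := by
    rintro _ ⟨e, he, rfl⟩
    exact (hj e).trans he
  have := eq_of_subset_of_ncard_le hsub
    (by rw [ncard_image_of_injective _ hji, heq]) (hμ.finite_fiber _)
  obtain ⟨e, -, he⟩ : x ∈ j '' (π ⁻¹' {μ x}) := this ▸ rfl
  exact ⟨e, he⟩

end Matching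

namespace EtaleGroupoid

variable {G : Type u} {X : Type v} [TopologicalSpace G] [TopologicalSpace X]
  [LocallyCompactSpace G] [T2Space G] (𝒢 : EtaleGroupoid G X)

/-! ### Classes of pushforwards modulo boundaries -/

section ChainClass

/-- The class of a `1`-chain modulo the image of `δ₂`. The chain is not assumed to be a cycle, so
that a cycle can be split into pieces that are not. -/
def chainClass : C_c(G, ℤ) →+ C_c(G, ℤ) ⧸ 𝒢.δ₂.range := QuotientAddGroup.mk' 𝒢.δ₂.range

variable {Z : Type*} [TopologicalSpace Z]

theorem continuous_mul_comp {a b : Z → G} (ha : Continuous a) (hb : Continuous b)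
    (hab : ∀ z, 𝒢.src (a z) = 𝒢.rng (b z)) : Continuous fun z => 𝒢.mul (a z) (b z) :=
  𝒢.continuous_mul.comp_continuous (ha.prodMk hb) hab

theorem isLocalHomeomorph_of_src {a : Z → G} (ha : Continuous a)
    (h : IsLocalHomeomorph fun z => 𝒢.src (a z)) : IsLocalHomeomorph a :=
  IsLocalHomeomorph.of_comp (g := 𝒢.src) h 𝒢.isLocalHomeomorph_src ha

theorem isLocalHomeomorph_inv : IsLocalHomeomorph 𝒢.inv :=
  𝒢.isLocalHomeomorph_of_src 𝒢.continuous_inv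
    (by simpa only [𝒢.src_inv] using 𝒢.isLocalHomeomorph_rng)

variable [T2Space Z]

/-- Pushing a chain along `z ↦ (a z, b z)` into `G^(2)` and applying `δ₂` shows that products
become sums. -/
theorem chainClass_mul {a b c : Z → G} (ha : IsLocalHomeomorph a) (hb : IsLocalHomeomorph b)
    (hc : IsLocalHomeomorph c) (hab : ∀ z, 𝒢.src (a z) = 𝒢.rng (b z))
    (habc : ∀ z, c z = 𝒢.mul (a z) (b z)) (F : C_c(Z, ℤ)) :
    𝒢.chainClass (pushforward c hc F) =
      𝒢.chainClass (pushforward a ha F) + 𝒢.chainClass (pushforward b hb F) := by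
  let m : Z → 𝒢.Composable := fun z => ⟨(a z, b z), hab z⟩
  have hm : IsLocalHomeomorph m := by
    refine IsLocalHomeomorph.of_comp (g := 𝒢.face₀) ?_ 𝒢.isLocalHomeomorph_face₀ ?_
    · exact hb
    · exact (ha.continuous.prodMk hb.continuous).subtype_mk hab
  have h : 𝒢.δ₂ (pushforward m hm F) =
      pushforward b hb F - pushforward c hc F + pushforward a ha F := by
    simp only [δ₂, AddMonoidHom.sub_apply, AddMonoidHom.add_apply]
    rw [pushforward_comp m hm _ 𝒢.isLocalHomeomorph_face₀ b hb fun _ => rfl,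
      pushforward_comp m hm _ 𝒢.isLocalHomeomorph_face₁ c hc fun z => (habc z).symm,
      pushforward_comp m hm _ 𝒢.isLocalHomeomorph_face₂ a ha fun _ => rfl]
  have h0 : 𝒢.chainClass (𝒢.δ₂ (pushforward m hm F)) = 0 :=
    (QuotientAddGroup.eq_zero_iff _).mpr ⟨_, rfl⟩
  rw [h, map_add, map_sub] at h0
  rw [← sub_eq_zero, ← neg_eq_zero, ← h0]
  abel

theorem chainClass_unit {c : Z → G} (hc : IsLocalHomeomorph c) (h : ∀ z, c z ∈ range 𝒢.unit)
    (F : C_c(Z, ℤ)) : 𝒢.chainClass (pushforward c hc F) = 0 := by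
  have h1 : ∀ z, 𝒢.src (c z) = 𝒢.rng (c z) := fun z => by
    obtain ⟨x, hx⟩ := h z
    rw [← hx, 𝒢.src_unit, 𝒢.rng_unit]
  have h2 := 𝒢.chainClass_mul hc hc hc h1 (fun z => by
    obtain ⟨x, hx⟩ := h z
    conv_rhs => rw [← 𝒢.mul_unit (c z), ← hx, 𝒢.src_unit]
    have := 𝒢.mul_unit (𝒢.unit x)
    rw [𝒢.src_unit] at this
    rw [this, this, hx]) F
  simpa using h2

theorem chainClass_inv {a b : Z → G} (ha : IsLocalHomeomorph a) (hb : IsLocalHomeomorph b)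
    (hab : ∀ z, b z = 𝒢.inv (a z)) (F : C_c(Z, ℤ)) :
    𝒢.chainClass (pushforward b hb F) = -𝒢.chainClass (pushforward a ha F) := by
  have hc : IsLocalHomeomorph fun z => 𝒢.unit (𝒢.src (a z)) :=
    𝒢.isOpenEmbedding_unit.isLocalHomeomorph.comp (𝒢.isLocalHomeomorph_src.comp ha)
  have h := 𝒢.chainClass_mul hb ha hc (fun z => by rw [hab, 𝒢.src_inv])
    (fun z => by rw [hab, 𝒢.inv_mul]) F
  rw [𝒢.chainClass_unit hc fun z => ⟨_, rfl⟩] at h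
  exact eq_neg_of_add_eq_zero_left h.symm

/-- Adding the boundary `|f| + inv_* |f|` makes `f` nonnegative. -/
theorem exists_nonneg_chainClass_eq (f : C_c(G, ℤ)) :
    ∃ g : C_c(G, ℤ), (∀ x, 0 ≤ g x) ∧ 𝒢.chainClass g = 𝒢.chainClass f := by
  let F : C_c(G, ℤ) := f.compLeft ⟨fun n => |n|, continuous_of_discreteTopology⟩
  have hF : ∀ x, F x = |f x| := fun x =>
    CompactlySupportedContinuousMap.compLeft_apply (abs_zero (α := ℤ)) f x
  have hid : IsLocalHomeomorph (id : G → G) := (Homeomorph.refl G).isLocalHomeomorph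
  have h := 𝒢.chainClass_inv hid 𝒢.isLocalHomeomorph_inv (fun _ => rfl) F
  rw [pushforward_eq_self_of_fixed id hid fun _ => rfl] at h
  refine ⟨f + F + pushforward 𝒢.inv 𝒢.isLocalHomeomorph_inv F, fun x => ?_, ?_⟩
  · have h1 : 0 ≤ f x + F x := by
      rw [hF]; linarith [neg_abs_le (f x)]
    have h2 : 0 ≤ pushforward 𝒢.inv 𝒢.isLocalHomeomorph_inv F x := by
      rw [pushforward_apply]
      exact finsum_nonneg fun y => finsum_nonneg fun _ => by rw [hF]; exact abs_nonneg _
    exact add_nonneg h1 h2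
  · rw [map_add, map_add, h]
    abel

end ChainClass

/-! ### Conjugation by a continuous section of the source map -/

section Conjugate

/-- The map `g ↦ t(r(g)) g t(s(g))⁻¹`, for a section `t` of the source map. -/
def conjugate (t : X → G) (g : G) : G :=
  𝒢.mul (𝒢.mul (t (𝒢.rng g)) g) (𝒢.inv (t (𝒢.src g)))

variable {t : X → G}

theorem isLocalHomeomorph_section (ht : Continuous t) (hts : ∀ x, 𝒢.src (t x) = x) : IsLocalHomeomorph t :=
  𝒢.isLocalHomeomorph_of_src ht (by
    simp only [hts]
    exact (Homeomorph.refl X).isLocalHomeomorph)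

theorem src_conjugate (hts : ∀ x, 𝒢.src (t x) = x) (g : G) :
    𝒢.src (𝒢.conjugate t g) = 𝒢.rng (t (𝒢.src g)) := by
  rw [conjugate, 𝒢.src_mul _ _ (by rw [𝒢.src_mul _ _ (hts _), 𝒢.rng_inv, hts]), 𝒢.src_inv]

theorem rng_conjugate (hts : ∀ x, 𝒢.src (t x) = x) (g : G) :
    𝒢.rng (𝒢.conjugate t g) = 𝒢.rng (t (𝒢.rng g)) := by
  rw [conjugate, 𝒢.rng_mul _ _ (by rw [𝒢.src_mul _ _ (hts _), 𝒢.rng_inv, hts]),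
    𝒢.rng_mul _ _ (hts _)]

theorem isLocalHomeomorph_section_mul (ht : Continuous t) (hts : ∀ x, 𝒢.src (t x) = x) :
    IsLocalHomeomorph fun g => 𝒢.mul (t (𝒢.rng g)) g := by
  refine 𝒢.isLocalHomeomorph_of_src (𝒢.continuous_mul_comp
    (ht.comp 𝒢.isLocalHomeomorph_rng.continuous) continuous_id fun g => hts _) ?_
  have : (fun g => 𝒢.src (𝒢.mul (t (𝒢.rng g)) g)) = 𝒢.src :=
    funext fun g => 𝒢.src_mul _ _ (hts _)
  rw [this]
  exact 𝒢.isLocalHomeomorph_src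

theorem isLocalHomeomorph_conjugate (ht : Continuous t) (hts : ∀ x, 𝒢.src (t x) = x) : IsLocalHomeomorph (𝒢.conjugate t) := by
  refine 𝒢.isLocalHomeomorph_of_src (𝒢.continuous_mul_comp
    (𝒢.isLocalHomeomorph_section_mul ht hts).continuous
    (𝒢.continuous_inv.comp (ht.comp 𝒢.isLocalHomeomorph_src.continuous))
    fun g => by rw [𝒢.src_mul _ _ (hts _), 𝒢.rng_inv, hts]) ?_
  rw [funext (𝒢.src_conjugate hts)]
  exact (𝒢.isLocalHomeomorph_rng.comp (𝒢.isLocalHomeomorph_section ht hts)).comp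
    𝒢.isLocalHomeomorph_src

/-- The class changes by `t_* (r_* F) - t_* (s_* F)`, that is by `-t_* (δ₁ F)`. -/
theorem chainClass_conjugate (ht : Continuous t) (hts : ∀ x, 𝒢.src (t x) = x)
    {F : C_c(G, ℤ)} (hF : 𝒢.δ₁ F = 0) :
    𝒢.chainClass (pushforward _ (𝒢.isLocalHomeomorph_conjugate ht hts) F) = 𝒢.chainClass F := by
  have := 𝒢.t2Space_units
  have h0 : pushforward _ 𝒢.isLocalHomeomorph_src F =
      pushforward _ 𝒢.isLocalHomeomorph_rng F := sub_eq_zero.mp hF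
  have htl := 𝒢.isLocalHomeomorph_section ht hts
  have hid : IsLocalHomeomorph (id : G → G) := (Homeomorph.refl G).isLocalHomeomorph
  have hr := htl.comp 𝒢.isLocalHomeomorph_rng
  have hs := htl.comp 𝒢.isLocalHomeomorph_src
  have hm := 𝒢.isLocalHomeomorph_section_mul ht hts
  have hi : IsLocalHomeomorph fun g => 𝒢.inv (t (𝒢.src g)) := 𝒢.isLocalHomeomorph_inv.comp hs
  have h1 := 𝒢.chainClass_mul hm hi (𝒢.isLocalHomeomorph_conjugate ht hts)
    (fun g => by rw [𝒢.src_mul _ _ (hts _), 𝒢.rng_inv, hts]) (fun _ => rfl) F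
  have h2 := 𝒢.chainClass_inv hs hi (fun _ => rfl) F
  have h3 := 𝒢.chainClass_mul hr hid hm (fun g => hts _) (fun _ => rfl) F
  rw [h1, h2, h3, pushforward_eq_self_of_fixed id hid fun _ => rfl,
    ← pushforward_comp _ 𝒢.isLocalHomeomorph_rng _ htl _ hr (fun _ => rfl),
    ← pushforward_comp _ 𝒢.isLocalHomeomorph_src _ htl _ hs (fun _ => rfl), h0]
  abel

end Conjugate

/-! ### Orbit representatives of an elementary subgroupoid -/

section Elementary

variable {𝒢} {K : Set G}

theorem IsElementary.eq_of_src_eq_of_rng_eq (hK : 𝒢.IsElementary K) {k l : G} (hk : k ∈ K)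
    (hl : l ∈ K) (hs : 𝒢.src k = 𝒢.src l) (hr : 𝒢.rng k = 𝒢.rng l) : k = l := by
  have hc : 𝒢.src (𝒢.inv k) = 𝒢.rng l := by rw [𝒢.src_inv, hr]
  obtain ⟨x, hx⟩ := hK.principal _ (hK.mul_mem _ (hK.inv_mem k hk) l hl hc)
    (by rw [𝒢.rng_mul _ _ hc, 𝒢.src_mul _ _ hc, 𝒢.rng_inv, hs])
  exact 𝒢.eq_of_inv_mul_eq_unit hr hx.symm

theorem IsElementary.exists_mul_inv (hK : 𝒢.IsElementary K) {k l : G} (hk : k ∈ K)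
    (hl : l ∈ K) (hs : 𝒢.src k = 𝒢.src l) : ∃ m ∈ K, 𝒢.src m = 𝒢.rng l ∧ 𝒢.rng m = 𝒢.rng k := by
  have hc : 𝒢.src k = 𝒢.rng (𝒢.inv l) := by rw [𝒢.rng_inv, hs]
  exact ⟨_, hK.mul_mem k hk _ (hK.inv_mem l hl) hc,
    by rw [𝒢.src_mul _ _ hc, 𝒢.src_inv], 𝒢.rng_mul _ _ hc⟩

/-- A continuous choice of an arrow `t x` of `K` from each unit `x` to a representative of its
`K`-orbit. A locally constant function injective on `K`-orbits exists since `K \ G^(0)` is compact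
and `K` is principal; the representative is the point of the orbit where it is least. -/
theorem IsElementary.exists_section [CompactSpace X] [TotallyDisconnectedSpace X]
    (hK : 𝒢.IsElementary K) :
    ∃ t : X → G, Continuous t ∧ (∀ x, 𝒢.src (t x) = x) ∧ (∀ x, t x ∈ K) ∧
      ∀ k ∈ K, 𝒢.mul (t (𝒢.rng k)) k = t (𝒢.src k) := by
  have := 𝒢.t2Space_units
  have hsc := 𝒢.isLocalHomeomorph_src.continuous
  have hrc := 𝒢.isLocalHomeomorph_rng.continuous
  obtain ⟨φ, hφc, hφ⟩ := exists_continuous_nat_separating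
    (D := (fun k => (𝒢.rng k, 𝒢.src k)) '' (K \ range 𝒢.unit))
    ((hK.isCompact.diff 𝒢.isOpenEmbedding_unit.isOpen_range).image (hrc.prodMk hsc)) (by
      rintro _ ⟨k, ⟨hk, hku⟩, rfl⟩ h
      exact hku (hK.principal k hk h))
  have hφK : ∀ k ∈ K, ∀ l ∈ K, 𝒢.src k = 𝒢.src l → φ (𝒢.rng k) = φ (𝒢.rng l) → k = l := by
    intro k hk l hl hs h
    refine hK.eq_of_src_eq_of_rng_eq hk hl hs ?_
    obtain ⟨m, hm, hms, hmr⟩ := hK.exists_mul_inv hk hl hs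
    by_contra hne
    refine hφ _ ⟨m, ⟨hm, ?_⟩, rfl⟩ (by simp only [hms, hmr, h])
    rintro ⟨x, rfl⟩
    rw [𝒢.src_unit] at hms
    rw [𝒢.rng_unit] at hmr
    exact hne (hmr.symm.trans hms)
  have hex : ∀ x, ∃ k : K, 𝒢.src k = x ∧ ∀ l ∈ K, 𝒢.src l = x → φ (𝒢.rng k) ≤ φ (𝒢.rng l) := by
    intro x
    let n : ℕ := sInf {n | ∃ l ∈ K, 𝒢.src l = x ∧ φ (𝒢.rng l) = n}
    obtain ⟨k, hk, hkx, hkn⟩ : n ∈ {n | ∃ l ∈ K, 𝒢.src l = x ∧ φ (𝒢.rng l) = n} :=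
      Nat.sInf_mem ⟨_, _, hK.unit_mem x, 𝒢.src_unit x, rfl⟩
    exact ⟨⟨k, hk⟩, hkx, fun l hl hlx => hkn.le.trans (Nat.sInf_le ⟨l, hl, hlx, rfl⟩)⟩
  choose t hts htm using hex
  have huniq : ∀ x, ∀ k ∈ K, 𝒢.src k = x →
      (∀ l ∈ K, 𝒢.src l = x → φ (𝒢.rng k) ≤ φ (𝒢.rng l)) → k = t x := fun x k hk hkx hkm =>
    hφK k hk (t x) (t x).2 (hkx.trans (hts x).symm)
      (le_antisymm (hkm _ (t x).2 (hts x)) (htm x k hk hkx))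
  have hcK : CompactSpace K := isCompact_iff_compactSpace.mp hK.isCompact
  have htc : Continuous t := by
    apply continuous_of_isClosed_graph_of_compact
    have : {p : X × K | p.2 = t p.1} = {p | 𝒢.src p.2 = p.1} ∩
        (⋃ m : ℕ, (𝒢.src '' (K ∩ {l | φ (𝒢.rng l) < m})) ×ˢ {k : K | φ (𝒢.rng k) = m})ᶜ := by
      ext ⟨x, k⟩
      simp only [mem_ofPred_eq, mem_inter_iff, mem_compl_iff, mem_iUnion, mem_prod, mem_image,
        not_exists, not_and]
      constructor
      · rintro rfl
        refine ⟨hts x, fun m h hm => ?_⟩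
        obtain ⟨l, ⟨hl, hlm⟩, hlx⟩ := h
        exact (htm x l hl hlx).not_gt (hm ▸ hlm)
      · rintro ⟨h1, h2⟩
        refine Subtype.ext (huniq x k k.2 h1 fun l hl hlx => ?_)
        by_contra hlt
        exact h2 _ ⟨l, ⟨hl, not_le.mp hlt⟩, hlx⟩ rfl
    rw [this]
    refine (isClosed_eq (hsc.comp (continuous_subtype_val.comp continuous_snd))
      continuous_fst).inter (isOpen_iUnion fun m => IsOpen.prod ?_ ?_).isClosed_compl
    · exact 𝒢.isLocalHomeomorph_src.isOpenMap _
        (hK.isOpen.inter ((isOpen_discrete (Iio m)).preimage (hφc.comp hrc)))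
    · exact (isOpen_discrete {m}).preimage (hφc.comp (hrc.comp continuous_subtype_val))
  refine ⟨fun x => t x, continuous_subtype_val.comp htc, hts, fun x => (t x).2, fun k hk => ?_⟩
  have hc : 𝒢.src (t (𝒢.rng k)) = 𝒢.rng k := hts _
  refine huniq _ _ (hK.mul_mem _ (t _).2 k hk hc) (𝒢.src_mul _ _ hc) fun l hl hlk => ?_
  obtain ⟨m, hm, hms, hmr⟩ := hK.exists_mul_inv hl hk hlk
  rw [𝒢.rng_mul _ _ hc, ← hmr]
  exact htm _ m hm hms

end Elementary

/-! ### Compact open `G`-sets defining elements of the full group -/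

section Realization

theorem exists_represents_of_isGSet [CompactSpace X] {U : Set G} (ho : IsOpen U)
    (hc : IsCompact U) (hU : 𝒢.IsGSet U) (hs : 𝒢.src '' U = univ) (hr : 𝒢.rng '' U = univ) :
    ∃ γ : X ≃ₜ X, 𝒢.Represents U γ := by
  have := 𝒢.t2Space_units
  have hcU : CompactSpace U := isCompact_iff_compactSpace.mp hc
  have key : ∀ p : G → X, Continuous p → InjOn p U → p '' U = univ →
      ∃ e : U ≃ₜ X, ∀ g : U, e g = p g := by
    intro p hp hi hsurj
    have hb : Function.Bijective fun g : U => p g :=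
      ⟨injOn_iff_injective.mp hi, fun x => by
        obtain ⟨g, hg, hgx⟩ : x ∈ p '' U := hsurj ▸ mem_univ x
        exact ⟨⟨g, hg⟩, hgx⟩⟩
    exact ⟨Continuous.homeoOfEquivCompactToT2 (f := Equiv.ofBijective _ hb)
      (hp.comp continuous_subtype_val), fun _ => rfl⟩
  obtain ⟨es, hes⟩ := key _ 𝒢.isLocalHomeomorph_src.continuous hU.1 hs
  obtain ⟨er, her⟩ := key _ 𝒢.isLocalHomeomorph_rng.continuous hU.2 hr
  refine ⟨es.symm.trans er, ho, hc, hU, hs, hr, fun g hg => ?_⟩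
  have h1 : es.symm (𝒢.src g) = ⟨g, hg⟩ := by
    rw [Homeomorph.symm_apply_eq, hes]
  rw [Homeomorph.trans_apply, h1, her]

/-- A compact open `G`-set with equal source and range is completed by units. -/
theorem exists_represents_chainClass_eq [CompactSpace X] {E : Type*} [TopologicalSpace E]
    [CompactSpace E] [T2Space E] {v : E → G} (hv : IsLocalHomeomorph v)
    (hs : Function.Injective fun e => 𝒢.src (v e)) (hr : Function.Injective fun e => 𝒢.rng (v e))
    (hrange : range (fun e => 𝒢.src (v e)) = range fun e => 𝒢.rng (v e)) :
    ∃ (γ : X ≃ₜ X) (U : Set G) (hU : 𝒢.Represents U γ),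
      𝒢.chainClass (charFn U hU.isOpen hU.isCompact) =
        𝒢.chainClass (pushforward v hv (oneFn E)) := by
  have := 𝒢.t2Space_units
  set A : Set X := range fun e => 𝒢.src (v e) with hA
  have hsl : IsLocalHomeomorph fun e => 𝒢.src (v e) := 𝒢.isLocalHomeomorph_src.comp hv
  have hAo : IsOpen A := hsl.isOpenMap.isOpen_range
  have hAc : IsClosed A := (isCompact_range hsl.continuous).isClosed
  have hul := 𝒢.isOpenEmbedding_unit.isLocalHomeomorph
  have ho1 : IsOpen (v '' univ) := hv.isOpenMap _ isOpen_univ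
  have hc1 : IsCompact (v '' univ) := isCompact_univ.image hv.continuous
  have ho2 : IsOpen (𝒢.unit '' Aᶜ) := hul.isOpenMap _ hAc.isOpen_compl
  have hc2 : IsCompact (𝒢.unit '' Aᶜ) := hAo.isClosed_compl.isCompact.image hul.continuous
  have key : ∀ p : G → X, (∀ x, p (𝒢.unit x) = x) → Function.Injective (fun e => p (v e)) →
      (range fun e => p (v e)) = A → InjOn p (v '' univ ∪ 𝒢.unit '' Aᶜ) ∧
        p '' (v '' univ ∪ 𝒢.unit '' Aᶜ) = univ := by
    intro p hpu hpi hpA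
    have hpm : ∀ e, p (v e) ∈ A := fun e => hpA ▸ mem_range_self e
    constructor
    · rintro _ (⟨e, -, rfl⟩ | ⟨x, hx, rfl⟩) _ (⟨e', -, rfl⟩ | ⟨x', hx', rfl⟩) h
      · rw [hpi h]
      · rw [hpu] at h; exact (hx' (h ▸ hpm e)).elim
      · rw [hpu] at h; exact (hx (h ▸ hpm e')).elim
      · rw [hpu, hpu] at h; rw [h]
    · refine eq_univ_of_forall fun x => ?_
      by_cases hx : x ∈ A
      · rw [← hpA] at hx
        obtain ⟨e, rfl⟩ := hx
        exact ⟨v e, Or.inl ⟨e, mem_univ e, rfl⟩, rfl⟩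
      · exact ⟨𝒢.unit x, Or.inr ⟨x, hx, rfl⟩, hpu x⟩
  obtain ⟨hs1, hs2⟩ := key 𝒢.src 𝒢.src_unit hs rfl
  obtain ⟨hr1, hr2⟩ := key 𝒢.rng 𝒢.rng_unit hr hrange.symm
  obtain ⟨γ, hγ⟩ := 𝒢.exists_represents_of_isGSet (ho1.union ho2) (hc1.union hc2) ⟨hs1, hr1⟩ hs2 hr2
  refine ⟨γ, _, hγ, ?_⟩
  have hsum : charFn _ hγ.isOpen hγ.isCompact = charFn _ ho1 hc1 + charFn _ ho2 hc2 := by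
    ext g
    have hd : Disjoint (v '' univ) (𝒢.unit '' Aᶜ) := by
      rw [Set.disjoint_left]
      rintro _ ⟨e, -, rfl⟩ ⟨x, hx, hxe⟩
      refine hx ⟨e, ?_⟩
      show 𝒢.src (v e) = x
      rw [← hxe, 𝒢.src_unit]
    exact congrFun (indicator_union_of_disjoint hd fun _ => (1 : ℤ)) g
  have hvi : Function.Injective v := fun a b h => hs (congrArg 𝒢.src h)
  rw [hsum, map_add, ← pushforward_charFn_of_injective v hv hvi isOpen_univ isCompact_univ,
    ← pushforward_charFn_of_injective 𝒢.unit hul 𝒢.isOpenEmbedding_unit.injective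
      hAc.isOpen_compl hAo.isClosed_compl.isCompact,
    𝒢.chainClass_unit hul mem_range_self, add_zero]

end Realization

/-! ### The part of a nonnegative chain outside a subgroupoid -/

section Layers

theorem isLocalHomeomorph_snd_of_discrete {ι H : Type*} [TopologicalSpace ι] [DiscreteTopology ι]
    [TopologicalSpace H] : IsLocalHomeomorph (Prod.snd : ι × H → H) := by
  refine IsLocalHomeomorph.mk _ fun p => ⟨
    { toFun := Prod.snd
      invFun := fun h => (p.1, h)
      source := {p.1} ×ˢ univ
      target := univ
      map_source' := fun _ _ => mem_univ _
      map_target' := fun _ _ => ⟨rfl, mem_univ _⟩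
      left_inv' := fun q hq => Prod.ext hq.1.symm rfl
      right_inv' := fun _ _ => rfl
      open_source := (isOpen_discrete _).prod isOpen_univ
      open_target := isOpen_univ
      continuousOn_toFun := continuous_snd.continuousOn
      continuousOn_invFun := (Continuous.prodMk_right p.1).continuousOn },
    ⟨rfl, mem_univ _⟩, fun _ _ => rfl⟩

variable {H : Type*} [TopologicalSpace H]

/-- The layers of a chain `f ≥ 0` outside `K`: over each `g ∉ K` there are `f g` points `(i, g)`,
`i < f g`. -/
abbrev Layers (f : C_c(H, ℤ)) (K : Set H) : Type _ := {e : ℕ × H // (e.1 : ℤ) < f e.2 ∧ e.2 ∉ K}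

theorem isClopen_layers (f : C_c(H, ℤ)) {K : Set H} (hK : IsClopen K) :
    IsClopen {e : ℕ × H | (e.1 : ℤ) < f e.2 ∧ e.2 ∉ K} := by
  have h1 : Continuous fun e : ℕ × H => (e.1, f e.2) :=
    continuous_fst.prodMk (f.continuous.comp continuous_snd)
  exact ((isClopen_discrete {q : ℕ × ℤ | (q.1 : ℤ) < q.2}).preimage h1).inter
    (hK.compl.preimage continuous_snd)

theorem compactSpace_layers (f : C_c(H, ℤ)) {K : Set H} (hK : IsClopen K) :
    CompactSpace (Layers f K) := by
  obtain ⟨M, hM⟩ := (isCompact_support_of_cc f).bddAbove_image f.continuous.continuousOn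
  refine isCompact_iff_compactSpace.mp (((finite_Iio M.toNat).isCompact.prod (isCompact_support_of_cc f)).of_isClosed_subset
    (isClopen_layers f hK).isClosed ?_)
  rintro ⟨i, h⟩ ⟨h1, -⟩
  have h1 : (i : ℤ) < f h := h1
  have h2 : h ∈ Function.support f := by
    intro h0
    rw [h0] at h1
    omega
  have h3 : f h ≤ M := hM ⟨h, h2, rfl⟩
  exact ⟨show i < M.toNat by omega, h2⟩

theorem isLocalHomeomorph_layers (f : C_c(H, ℤ)) {K : Set H} (hK : IsClopen K) :
    IsLocalHomeomorph fun e : Layers f K => e.1.2 :=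
  isLocalHomeomorph_snd_of_discrete.comp
    (isClopen_layers f hK).isOpen.isOpenEmbedding_subtypeVal.isLocalHomeomorph

theorem ncard_fiber_layers {f : C_c(H, ℤ)} (hf : ∀ h, 0 ≤ f h) {K : Set H} {h : H} (hh : h ∉ K) :
    (((fun e : Layers f K => e.1.2) ⁻¹' {h}).ncard : ℤ) = f h := by
  have : Subtype.val '' ((fun e : Layers f K => e.1.2) ⁻¹' {h}) =
      (fun i : ℕ => (i, h)) '' (Finset.range (f h).toNat : Set ℕ) := by
    ext ⟨i, k⟩
    simp only [mem_image, mem_preimage, mem_singleton_iff, Finset.coe_range, mem_Iio,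
      Prod.mk.injEq]
    constructor
    · rintro ⟨⟨e, he⟩, rfl, rfl⟩
      exact ⟨i, by have := he.1; dsimp only at this ⊢; omega, rfl, rfl⟩
    · rintro ⟨j, hj, rfl, rfl⟩
      exact ⟨⟨(j, h), by dsimp only; omega, hh⟩, rfl, rfl⟩
  rw [← ncard_image_of_injective _ Subtype.val_injective, this,
    ncard_image_of_injective _ fun a b hab => (Prod.ext_iff.mp hab).1, ncard_coe_finset,
    Finset.card_range, Int.toNat_of_nonneg (hf h)]

theorem pushforward_layers [T2Space H] {f : C_c(H, ℤ)} (hf : ∀ h, 0 ≤ f h) {K : Set H}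
    (hK : IsClopen K) [CompactSpace (Layers f K)] (h : H) :
    pushforward _ (isLocalHomeomorph_layers f hK) (oneFn (Layers f K)) h =
      Kᶜ.indicator f h := by
  rw [pushforward_oneFn]
  by_cases hh : h ∈ K
  · have : (fun e : Layers f K => e.1.2) ⁻¹' {h} = ∅ :=
      eq_empty_of_forall_notMem fun e he => e.2.2 ((show e.1.2 = h from he) ▸ hh)
    rw [this, indicator_of_notMem (not_not_intro hh)]
    simp
  · rw [ncard_fiber_layers hf hh, indicator_of_mem hh]

end Layers

/-! ### Counting arrows that leave an orbit -/

section Counting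

variable {𝒢} {K : Set G}

theorem sourceFiber_finite (hK : IsCompact K) (x : X) : (𝒢.sourceFiber K x).Finite := by
  have := 𝒢.t2Space_units
  refine (finite_fiber_inter 𝒢.isLocalHomeomorph_src hK x).subset ?_
  rintro g ⟨hg, hx⟩
  exact ⟨hx, hg⟩

theorem IsElementary.orbit_eq_preimage (hK : 𝒢.IsElementary K) {t : X → G}
    (hts : ∀ x, 𝒢.src (t x) = x) (htK : ∀ x, t x ∈ K)
    (htm : ∀ k ∈ K, 𝒢.mul (t (𝒢.rng k)) k = t (𝒢.src k)) (x : X) :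
    𝒢.orbit K x = (fun y => 𝒢.rng (t y)) ⁻¹' {𝒢.rng (t x)} := by
  ext y
  constructor
  · rintro ⟨k, ⟨hk, rfl⟩, rfl⟩
    show 𝒢.rng (t (𝒢.rng k)) = 𝒢.rng (t (𝒢.src k))
    rw [← htm k hk, 𝒢.rng_mul _ _ (hts _)]
  · intro (h : 𝒢.rng (t y) = 𝒢.rng (t x))
    have hc : 𝒢.src (𝒢.inv (t y)) = 𝒢.rng (t x) := by rw [𝒢.src_inv, h]
    exact ⟨_, ⟨hK.mul_mem _ (hK.inv_mem _ (htK y)) _ (htK x) hc,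
      (𝒢.src_mul _ _ hc).trans (hts x)⟩, by rw [𝒢.rng_mul _ _ hc, 𝒢.rng_inv, hts]⟩

/-- An arrow `a e ∉ K` of `C` starting in the orbit of `x` gives the element `a e · k` of
`C K x \ K x`, where `k ∈ K` leads from `x` to the source of `a e`. The range of `a e` is not
changed, so an element arises at most `n` times. -/
theorem IsElementary.ncard_leaving_le (hK : 𝒢.IsElementary K) {C : Set G} (hC : IsCompact C)
    {E : Type*} {a : E → G} (haC : ∀ e, a e ∈ C) (haK : ∀ e, a e ∉ K) {n : ℕ}
    (hfin : ∀ y, ((fun e => 𝒢.rng (a e)) ⁻¹' {y}).Finite)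
    (hn : ∀ y, ((fun e => 𝒢.rng (a e)) ⁻¹' {y}).ncard ≤ n) {x : X} {T : Set E} (hT : T.Finite)
    (hTx : ∀ e ∈ T, 𝒢.src (a e) ∈ 𝒢.orbit K x) :
    T.ncard ≤ n * (𝒢.setMul C (𝒢.sourceFiber K x) \ 𝒢.sourceFiber K x).ncard := by
  classical
  have := 𝒢.t2Space_units
  rcases T.eq_empty_or_nonempty with rfl | ⟨e₀, -⟩
  · simp
  have : Nonempty G := ⟨a e₀⟩
  set S := 𝒢.setMul C (𝒢.sourceFiber K x) \ 𝒢.sourceFiber K x with hS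
  have hSfin : S.Finite := by
    refine (sourceFiber_finite (𝒢 := 𝒢) (𝒢.isCompact_setMul hC hK.isCompact) x).subset ?_
    rintro _ ⟨⟨⟨⟨c, k⟩, hck⟩, ⟨hc, hk⟩, rfl⟩, -⟩
    exact ⟨⟨⟨(c, k), hck⟩, ⟨hc, hk.1⟩, rfl⟩, (𝒢.src_mul _ _ hck).trans hk.2⟩
  have hex : ∀ e ∈ T, ∃ g ∈ S, 𝒢.rng g = 𝒢.rng (a e) := by
    intro e he
    obtain ⟨k, ⟨hk, hkx⟩, hke⟩ := hTx e he
    refine ⟨𝒢.mul (a e) k, ⟨⟨⟨(a e, k), hke.symm⟩, ⟨haC e, hk, hkx⟩, rfl⟩, fun h => haK e ?_⟩,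
      𝒢.rng_mul _ _ hke.symm⟩
    have h1 := hK.mul_mem _ h.1 _ (hK.inv_mem k hk)
      (by rw [𝒢.src_mul _ _ hke.symm, 𝒢.rng_inv])
    rwa [𝒢.mul_assoc _ _ _ hke.symm (𝒢.rng_inv k).symm, 𝒢.mul_inv, hke, 𝒢.mul_unit] at h1
  choose! w hwS hw using hex
  rw [ncard_eq_toFinset_card _ hT, ncard_eq_toFinset_card _ hSfin]
  refine Finset.card_le_mul_card_image_of_maps_to (f := w) (fun e he => ?_) n fun g _ => ?_
  · simpa using hwS e (by simpa using he)
  · refine le_trans ?_ (hn (𝒢.rng g))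
    rw [← ncard_coe_finset]
    refine ncard_le_ncard (fun e he => ?_) (hfin _)
    simp only [Finset.coe_filter, Finite.mem_toFinset, mem_ofPred_eq] at he
    exact (hw e he.1).symm.trans (congrArg 𝒢.rng he.2)

theorem IsElementary.mul_ncard_le_ncard_orbit (hK : 𝒢.IsElementary K) {x : X} {n N : ℕ}
    (h : (N : ℝ) / ((𝒢.orbit K x).ncard : ℝ) < 1 / ((n : ℝ) + 1)) :
    n * N ≤ (𝒢.orbit K x).ncard := by
  have hpos : 0 < (𝒢.orbit K x).ncard :=
    (ncard_pos ((sourceFiber_finite hK.isCompact x).image _)).mpr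
      ⟨_, 𝒢.unit x, ⟨hK.unit_mem x, 𝒢.src_unit x⟩, rfl⟩
  rw [div_lt_div_iff₀ (by exact_mod_cast hpos) (by positivity), one_mul] at h
  have h' : N * (n + 1) < (𝒢.orbit K x).ncard := by exact_mod_cast h
  nlinarith

end Counting

/-! ### Surjectivity of the index map -/

/-- The points `j₁ e` and `j₁ (j' e)` become the source and the range of the arrow `w e`, multiplied
on both sides by arrows `t (j₁ e)` and `t (j₁ (j' e))⁻¹`. Since `j'` permutes `E`, the contributions
of these two families of arrows to the class cancel. -/
theorem exists_represents_of_matching [CompactSpace X] {t : X → G} (ht : Continuous t)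
    (hts : ∀ x, 𝒢.src (t x) = x) {E : Type*} [TopologicalSpace E] [CompactSpace E] [T2Space E]
    {w : E → G} (hw : IsLocalHomeomorph w) {j₁ : E → X} (hj₁ : Continuous j₁)
    (hi : Function.Injective j₁) (hμ₁ : ∀ e, 𝒢.rng (t (j₁ e)) = 𝒢.src (w e)) {j' : E → E}
    (hj' : Continuous j') (hb : Function.Bijective j')
    (hμ₂ : ∀ e, 𝒢.rng (t (j₁ (j' e))) = 𝒢.rng (w e)) :
    ∃ (γ : X ≃ₜ X) (U : Set G) (hU : 𝒢.Represents U γ),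
      𝒢.chainClass (charFn U hU.isOpen hU.isCompact) =
        𝒢.chainClass (pushforward w hw (oneFn E)) := by
  have := 𝒢.t2Space_units
  have htl := 𝒢.isLocalHomeomorph_section ht hts
  have hj₁l : IsLocalHomeomorph j₁ := by
    refine IsLocalHomeomorph.of_comp (g := fun x => 𝒢.rng (t x)) ?_
      (𝒢.isLocalHomeomorph_rng.comp htl) hj₁
    have h : (fun x => 𝒢.rng (t x)) ∘ j₁ = 𝒢.src ∘ w := funext hμ₁
    rw [h]
    exact 𝒢.isLocalHomeomorph_src.comp hw
  have hj'l : IsLocalHomeomorph j' :=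
    (Continuous.homeoOfEquivCompactToT2 (f := Equiv.ofBijective j' hb) hj').isLocalHomeomorph
  have hj'1 : pushforward j' hj'l (oneFn E) = oneFn E := by
    ext e
    rw [pushforward_charFn _ _ _ _ hb.1.injOn (image_univ_of_surjective hb.2), charFn_apply]
    simp
  have h1 : IsLocalHomeomorph fun e => t (j₁ e) := htl.comp hj₁l
  have h2 : IsLocalHomeomorph fun e => t (j₁ (j' e)) := h1.comp hj'l
  have h3 : IsLocalHomeomorph fun e => 𝒢.inv (t (j₁ (j' e))) := 𝒢.isLocalHomeomorph_inv.comp h2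
  have hc1 : ∀ e, 𝒢.src (w e) = 𝒢.rng (t (j₁ e)) := fun e => (hμ₁ e).symm
  have hs1 : ∀ e, 𝒢.src (𝒢.mul (w e) (t (j₁ e))) = j₁ e := fun e => by
    rw [𝒢.src_mul _ _ (hc1 e), hts]
  have h4 : IsLocalHomeomorph fun e => 𝒢.mul (w e) (t (j₁ e)) :=
    𝒢.isLocalHomeomorph_of_src (𝒢.continuous_mul_comp hw.continuous h1.continuous hc1)
      (by simpa only [hs1] using hj₁l)
  have hc2 : ∀ e, 𝒢.src (𝒢.inv (t (j₁ (j' e)))) = 𝒢.rng (𝒢.mul (w e) (t (j₁ e))) := fun e => by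
    rw [𝒢.src_inv, 𝒢.rng_mul _ _ (hc1 e), hμ₂]
  have hs2 : ∀ e, 𝒢.src (𝒢.mul (𝒢.inv (t (j₁ (j' e)))) (𝒢.mul (w e) (t (j₁ e)))) = j₁ e :=
    fun e => by rw [𝒢.src_mul _ _ (hc2 e), hs1]
  have hr2 : ∀ e, 𝒢.rng (𝒢.mul (𝒢.inv (t (j₁ (j' e)))) (𝒢.mul (w e) (t (j₁ e)))) = j₁ (j' e) :=
    fun e => by rw [𝒢.rng_mul _ _ (hc2 e), 𝒢.rng_inv, hts]
  have h5 : IsLocalHomeomorph fun e =>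
      𝒢.mul (𝒢.inv (t (j₁ (j' e)))) (𝒢.mul (w e) (t (j₁ e))) :=
    𝒢.isLocalHomeomorph_of_src (𝒢.continuous_mul_comp h3.continuous h4.continuous hc2)
      (by simpa only [hs2] using hj₁l)
  obtain ⟨γ, U, hU, hcl⟩ := 𝒢.exists_represents_chainClass_eq h5
    (by simpa only [hs2] using hi) (by
      simp only [hr2]
      exact hi.comp hb.1)
    (by simp only [hs2, hr2]; exact (hb.2.range_comp j₁).symm)
  refine ⟨γ, U, hU, hcl.trans ?_⟩
  rw [𝒢.chainClass_mul h3 h4 h5 hc2 fun _ => rfl, 𝒢.chainClass_mul hw h1 h4 hc1 fun _ => rfl,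
    𝒢.chainClass_inv h2 h3 fun _ => rfl,
    ← pushforward_comp j' hj'l _ h1 _ h2 fun _ => rfl, hj'1]
  abel

/-- A nonnegative cycle is homologous to the characteristic function of a `G`-set. The elementary
subgroupoid `K` is taken so invariant that the chain has fewer arrows leaving a `K`-orbit than the
orbit has points. -/
theorem exists_represents_of_nonneg [CompactSpace X] [TotallyDisconnectedSpace X]
    (hAF : 𝒢.AlmostFinite) {f : C_c(G, ℤ)} (hf : 𝒢.δ₁ f = 0) (hf0 : ∀ g, 0 ≤ f g) :
    ∃ (γ : X ≃ₜ X) (U : Set G) (hU : 𝒢.Represents U γ),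
      𝒢.chainClass (charFn U hU.isOpen hU.isCompact) = 𝒢.chainClass f := by
  have := 𝒢.t2Space_units
  have hsl := 𝒢.isLocalHomeomorph_src
  have hrl := 𝒢.isLocalHomeomorph_rng
  -- `n` bounds the number of arrows of the chain, with multiplicity, that have a given range.
  obtain ⟨n, hn⟩ : ∃ n : ℕ, ∀ y, pushforward _ hrl f y ≤ n := by
    obtain ⟨M, hM⟩ := (isCompact_range (pushforward _ hrl f).continuous).bddAbove
    exact ⟨M.toNat, fun y => (hM (mem_range_self y)).trans (Int.self_le_toNat M)⟩
  obtain ⟨K, hK, hKAF⟩ := hAF _ (isCompact_support_of_cc f) (1 / ((n : ℝ) + 1)) (by positivity)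
  obtain ⟨t, ht, hts, htK, htm⟩ := hK.exists_section
  have hKc : IsClopen K := ⟨hK.isCompact.isClosed, hK.isOpen⟩
  have htl := 𝒢.isLocalHomeomorph_section ht hts
  have hμ : IsLocalHomeomorph fun x => 𝒢.rng (t x) := hrl.comp htl
  have hEc : CompactSpace (Layers f K) := compactSpace_layers f hKc
  let a : Layers f K → G := fun e => e.1.2
  have ha : IsLocalHomeomorph a := isLocalHomeomorph_layers f hKc
  have hEt : TotallyDisconnectedSpace (Layers f K) :=
    totallyDisconnectedSpace_of_isLocalHomeomorph (hsl.comp ha)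
  have hw := 𝒢.isLocalHomeomorph_conjugate ht hts
  -- The chain is the sum of its layers outside `K` and of the part `h` inside `K`.
  set h : C_c(G, ℤ) := f - pushforward a ha (oneFn _) with hh
  have hhK : ∀ g, h g ≠ 0 → g ∈ K := by
    intro g hg
    by_contra hgK
    refine hg ?_
    show f g - pushforward a ha (oneFn _) g = 0
    rw [pushforward_layers hf0 hKc, indicator_of_mem hgK, sub_self]
  have hle : ∀ g, pushforward a ha (oneFn _) g ≤ f g := fun g => by
    rw [pushforward_layers hf0 hKc]
    exact indicator_le_self' (fun g _ => hf0 g) g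
  have hπs : IsLocalHomeomorph fun e => 𝒢.rng (t (𝒢.src (a e))) := hμ.comp (hsl.comp ha)
  have hπr : IsLocalHomeomorph fun e => 𝒢.rng (t (𝒢.rng (a e))) := hμ.comp (hrl.comp ha)
  have hms := hμ.comp hsl
  have hmr := hμ.comp hrl
  -- As many arrows outside `K` enter an orbit as leave it: this holds for all arrows of the chain
  -- since it is a cycle, and the arrows inside `K` do not change the orbit.
  have heq : ∀ y, ((fun e => 𝒢.rng (t (𝒢.rng (a e)))) ⁻¹' {y}).ncard =
      ((fun e => 𝒢.rng (t (𝒢.src (a e)))) ⁻¹' {y}).ncard := by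
    have h1 : pushforward _ hms f = pushforward _ hmr f := by
      rw [← pushforward_comp _ hsl _ hμ _ hms fun _ => rfl,
        ← pushforward_comp _ hrl _ hμ _ hmr fun _ => rfl]
      exact congrArg _ (sub_eq_zero.mp hf)
    have h2 : pushforward _ hms h = pushforward _ hmr h := by
      refine pushforward_congr _ _ _ _ fun g hg => ?_
      show 𝒢.rng (t (𝒢.src g)) = 𝒢.rng (t (𝒢.rng g))
      rw [← htm g (hhK g hg), 𝒢.rng_mul _ _ (hts _)]
    rw [hh, map_sub, map_sub, h1, sub_right_inj,
      pushforward_comp a ha _ hms _ hπs fun _ => rfl,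
      pushforward_comp a ha _ hmr _ hπr fun _ => rfl] at h2
    intro y
    have h3 := DFunLike.congr_fun h2 y
    rw [pushforward_oneFn, pushforward_oneFn] at h3
    exact_mod_cast h3.symm
  have hra := hrl.comp ha
  have hcard : ∀ y, ((fun e => 𝒢.rng (t (𝒢.src (a e)))) ⁻¹' {y}).ncard ≤
      ((fun x => 𝒢.rng (t x)) ⁻¹' {y}).ncard := by
    intro y
    rcases ((fun e => 𝒢.rng (t (𝒢.src (a e)))) ⁻¹' {y}).eq_empty_or_nonempty with h0 | ⟨e₀, he₀⟩
    · rw [h0, ncard_empty]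
      exact Nat.zero_le _
    · obtain rfl : 𝒢.rng (t (𝒢.src (a e₀))) = y := he₀
      rw [← hK.orbit_eq_preimage hts htK htm]
      refine le_trans ?_ (hK.mul_ncard_le_ncard_orbit (hKAF (𝒢.src (a e₀))))
      refine hK.ncard_leaving_le (isCompact_support_of_cc f) (a := a) (fun e => ?_)
        (fun e => e.2.2) (fun y => hra.finite_fiber y) (fun y => ?_) (hπs.finite_fiber _)
        fun e he => ?_
      · have he1 : (e.1.1 : ℤ) < f (a e) := e.2.1
        exact (by omega : f (a e) ≠ 0)
      · have h1 := (pushforward_mono _ hrl hle y).trans (hn y)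
        rw [pushforward_comp a ha _ hrl _ hra fun _ => rfl, pushforward_oneFn] at h1
        exact_mod_cast h1
      · rw [hK.orbit_eq_preimage hts htK htm]
        exact he
  obtain ⟨j₁, hj₁, hi, hj₁μ⟩ := exists_continuous_injective_lift hπs hμ hcard
  obtain ⟨j', hj', hb, hj'μ⟩ := exists_continuous_bijective_lift hπr hπs heq
  obtain ⟨γ, U, hU, hcl⟩ := 𝒢.exists_represents_of_matching ht hts (hw.comp ha) hj₁ hi
    (fun e => (hj₁μ e).trans (𝒢.src_conjugate hts _).symm) hj' hb
    (fun e => ((hj₁μ _).trans (hj'μ e)).trans (𝒢.rng_conjugate hts _).symm)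
  refine ⟨γ, U, hU, hcl.trans ?_⟩
  -- Conjugation by `t` maps `K` to units, so it kills the class of `h`.
  have hul : IsLocalHomeomorph fun g => 𝒢.unit (𝒢.rng (t (𝒢.src g))) :=
    𝒢.isOpenEmbedding_unit.isLocalHomeomorph.comp hms
  have hh0 : 𝒢.chainClass (pushforward _ hw h) = 0 := by
    rw [pushforward_congr _ _ hw hul (f := h) fun g hg => ?_,
      𝒢.chainClass_unit hul fun _ => mem_range_self _]
    rw [conjugate, htm g (hhK g hg), 𝒢.mul_inv]
  rw [hh, map_sub, map_sub, sub_eq_zero, pushforward_comp a ha _ hw _ (hw.comp ha) fun _ => rfl]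
    at hh0
  rw [← 𝒢.chainClass_conjugate ht hts hf, hh0]

theorem indexMap_eq_homologyClass [CompactSpace X] (hG : 𝒢.EssentiallyPrincipal)
    (γ : 𝒢.topFullGroup) (U : Set G) (hU : 𝒢.Represents U γ.1) :
    𝒢.indexMap hG γ = hU.homologyClass := by
  have h := (𝒢.existsUnique_represents hG γ).choose_spec.2 U hU
  subst h
  rfl

theorem Represents.homologyClass_eq_mk {U : Set G} {γ : X ≃ₜ X} {𝒢 : EtaleGroupoid G X}
    (hU : 𝒢.Represents U γ) (f : 𝒢.δ₁.ker)
    (h : 𝒢.chainClass (charFn U hU.isOpen hU.isCompact) = 𝒢.chainClass f) :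
    hU.homologyClass = QuotientAddGroup.mk f := by
  refine (QuotientAddGroup.eq).mpr ?_
  obtain ⟨F, hF⟩ := (QuotientAddGroup.eq).mp h
  exact ⟨F, Subtype.ext hF⟩

end EtaleGroupoid

end

theorem theorem7p5 {G : Type*} {X : Type*} [TopologicalSpace G] [TopologicalSpace X]
    [LocallyCompactSpace G] [T2Space G] [SecondCountableTopology G]
    [CompactSpace X] [TotallyDisconnectedSpace X] (𝒢 : EtaleGroupoid G X)
    (hG : 𝒢.EssentiallyPrincipal) (hAF : 𝒢.AlmostFinite) :
    (∀ (γ : 𝒢.topFullGroup) (U : Set G) (hU : 𝒢.Represents U γ.1),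
      𝒢.indexMap hG γ = hU.homologyClass) ∧
    Function.Surjective (𝒢.indexMap hG) := by
  refine ⟨𝒢.indexMap_eq_homologyClass hG, fun c => ?_⟩
  obtain ⟨f, rfl⟩ := QuotientAddGroup.mk_surjective c
  obtain ⟨g, hg0, hgf⟩ := 𝒢.exists_nonneg_chainClass_eq f
  have hg : 𝒢.δ₁ g = 0 := by
    obtain ⟨F, hF⟩ := (QuotientAddGroup.eq).mp hgf
    have h := 𝒢.δ₁_δ₂ F
    rwa [hF, map_add, map_neg, f.2, add_zero, neg_eq_zero] at h
  obtain ⟨γ, U, hU, hcl⟩ := 𝒢.exists_represents_of_nonneg hAF hg hg0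
  refine ⟨⟨γ, U, hU⟩, ?_⟩
  rw [𝒢.indexMap_eq_homologyClass hG _ U hU]
  exact hU.homologyClass_eq_mk f (hcl.trans hgf)
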